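/- For a finite multigraph $G=(V,E)$ and $q,w\in\mathbb{C}$ let $$Z_T(G)(q,w)=\sum_{A\subseteq E}q^{k(A)}w^{|A|},$$ where $k(A)$ is the number of connected components of the graph $(V,A)$. For $\varepsilon>0$, a complex number $\xi\neq 0$ is called a multiplicative $\varepsilon$-approximation to a complex number $z\ne 0$ if $e^{-\varepsilon}\le |z|/|\xi|\le e^{\varepsilon}$ and the angle between $\xi$ and $z$, seen as vectors in $\mathbb{C}=\mathbb{R}^2$, is at most $\varepsilon$. **Theorem.** Let $\Delta\in\mathbb{N}$ and $w\in\mathbb{C}$. There is a constant $K$, depending only on $\Delta$ and $w$, such that for every $q\in\mathbb{C}$ with $|q|>K$ there is a deterministic algorithm which, given a finite loopless multigraph $G=(V,E)$ of maximum degree at most $\Delta$ and a real number $\varepsilon>0$, computes a multiplicative $\varepsilon$-approximation to $Z_T(G)(q,w)$ (in particular, $Z_T(G)(q,w)\neq 0$) in time $(|V|/\varepsilon)^{O(1)}$. Here the running time is at most $C\,\bigl(\max(|V|,1)/\min(\varepsilon,1)\bigr)^{C}$ for a constant $C$ that does not depend on $G$ and $\varepsilon$. An algorithm is a program for a random access machine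 with memory cells for natural numbers (which can be added, subtracted, compared, and used as addresses) and for complex numbers (which can be added, subtracted, multiplied, divided, and compared by their real parts), each operation taking one unit of time. The multigraph is given by a list of its edges with respect to an arbitrary numbering of the vertices and edges, and $q$, $w$, $\varepsilon$ are given as complex numbers. -/

import Mathlib

open scoped Graph

/-! ### Multigraphs and the random-cluster form of the Tutte polynomial

Multigraphs are Mathlib's `Graph α β`: a vertex set `V(G)`, an edge set `E(G)` and the relation
`G.IsLink e x y` saying that `x` and `y` are the ends of the edge `e`. -/

namespace Graph

/-- The degree of a vertex: the number of incident edges, a loop being counted twice. -/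
noncomputable def degree {α β : Type*} (G : Graph α β) (v : α) : ℕ :=
  (G.incidenceSet v).ncard + (G.loopSet v).ncard

/-- The number of connected components: `Quot` is the quotient of the vertex set by the
equivalence relation generated by adjacency. -/
noncomputable def numComponents {α β : Type*} (G : Graph α β) : ℕ :=
  Nat.card (Quot fun x y : V(G) => G.Adj x.1 y.1)

/-- `Z_T(G)(q, w) = ∑_{A ⊆ E} q ^ k(A) * w ^ |A|`, where `k(A)` is the number of components of
the graph `(V, A)`. (A finite sum, as `E(G)` is finite wherever this is used.) -/
noncomputable def tutte {α β : Type*} (G : Graph α β) (q w : ℂ) : ℂ :=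
  ∑ᶠ A ∈ 𝒫 E(G), q ^ (G.restrict A).numComponents * w ^ A.ncard

/-- A presentation of a finite multigraph as an edge list: the vertices are numbered
`0, …, n - 1`, the edges `0, …, m - 1`, and the two ends of each edge are listed. -/
structure EdgeList {α β : Type*} (G : Graph α β) where
  n : ℕ
  m : ℕ
  vert : Fin n ≃ V(G)
  edge : Fin m ≃ E(G)
  fst : Fin m → Fin n
  snd : Fin m → Fin n
  isLink : ∀ i, G.IsLink (edge i) (vert (fst i)) (vert (snd i))

end Graph

/-- `ξ` is a multiplicative `ε`-approximation to `z`. -/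
def IsMultApprox (ε : ℝ) (z ξ : ℂ) : Prop :=
  z ≠ 0 ∧ ξ ≠ 0 ∧ Real.exp (-ε) ≤ ‖z‖ / ‖ξ‖ ∧ ‖z‖ / ‖ξ‖ ≤ Real.exp ε ∧
    InnerProductGeometry.angle ξ z ≤ ε

/-! ### Deterministic algorithms: a random access machine with exact complex arithmetic

The memory consists of countably many arrays of natural numbers and countably many arrays of
complex numbers. Natural numbers are added, subtracted (truncated at `0`) and compared, and serve
as array indices; complex numbers are added, subtracted, multiplied and divided, and their real
parts are compared. Every operation costs one unit of time. No complex constants are built in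
except those obtained from natural numbers, and no rounding of complex numbers to natural numbers
is available. A program is a finite text; it mentions only finitely many of the arrays. -/

namespace ComplexRAM

/-- A memory configuration: `s.nat x i` and `s.num x i` are the `i`-th entries of the `x`-th array
of natural numbers and of the `x`-th array of complex numbers. -/
structure State where
  nat : ℕ → ℕ → ℕ
  num : ℕ → ℕ → ℂ

/-- Write `v` to the entry `i` of the array `x` of natural numbers. -/
def State.setNat (s : State) (x i v : ℕ) : State :=
  { s with nat := Function.update s.nat x (Function.update (s.nat x) i v) }

/-- Write `v` to the entry `i` of the array `x` of complex numbers. -/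
noncomputable def State.setNum (s : State) (x i : ℕ) (v : ℂ) : State :=
  { s with num := Function.update s.num x (Function.update (s.num x) i v) }

/-- Expressions for natural numbers; `get x i` reads the entry `i` of the array `x`. -/
inductive NatExp
  | const (c : ℕ)
  | get (x : ℕ) (i : NatExp)
  | add (a b : NatExp)
  | sub (a b : NatExp)

def NatExp.eval (s : State) : NatExp → ℕ
  | const c => c
  | get x i => s.nat x (i.eval s)
  | add a b => a.eval s + b.eval s
  | sub a b => a.eval s - b.eval s

/-- The number of operations needed to evaluate an expression. -/
def NatExp.cost : NatExp → ℕ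
  | const _ => 1
  | get _ i => i.cost + 1
  | add a b => a.cost + b.cost + 1
  | sub a b => a.cost + b.cost + 1

/-- Expressions for complex numbers; `ofNat` converts a natural number to a complex number. -/
inductive NumExp
  | ofNat (a : NatExp)
  | get (x : ℕ) (i : NatExp)
  | add (a b : NumExp)
  | sub (a b : NumExp)
  | mul (a b : NumExp)
  | div (a b : NumExp)

noncomputable def NumExp.eval (s : State) : NumExp → ℂ
  | ofNat a => (a.eval s : ℂ)
  | get x i => s.num x (i.eval s)
  | add a b => a.eval s + b.eval s
  | sub a b => a.eval s - b.eval s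
  | mul a b => a.eval s * b.eval s
  | div a b => a.eval s / b.eval s

/-- The number of operations needed to evaluate an expression. -/
def NumExp.cost : NumExp → ℕ
  | ofNat a => a.cost + 1
  | get _ i => i.cost + 1
  | add a b => a.cost + b.cost + 1
  | sub a b => a.cost + b.cost + 1
  | mul a b => a.cost + b.cost + 1
  | div a b => a.cost + b.cost + 1

/-- Tests: `a ≤ b` for natural numbers, and `Re a ≤ Re b` for complex numbers. -/
inductive Test
  | natLe (a b : NatExp)
  | reLe (a b : NumExp)

def Test.Holds (s : State) : Test → Prop
  | natLe a b => a.eval s ≤ b.eval s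
  | reLe a b => (a.eval s).re ≤ (b.eval s).re

def Test.cost : Test → ℕ
  | natLe a b => a.cost + b.cost + 1
  | reLe a b => a.cost + b.cost + 1

/-- Programs: do nothing; assign the value of an expression to the entry `i` of the array `x`;
sequential composition; `if b then p else p'`; `while b do p`. -/
inductive Program
  | skip
  | setNat (x : ℕ) (i e : NatExp)
  | setNum (x : ℕ) (i : NatExp) (e : NumExp)
  | seq (p p' : Program)
  | branch (b : Test) (p p' : Program)
  | loop (b : Test) (p : Program)

/-- `Exec p s s' t`: started in the memory configuration `s`, the program `p` halts after exactly
`t` steps in the memory configuration `s'`. -/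
inductive Exec : Program → State → State → ℕ → Prop
  | skip (s : State) : Exec .skip s s 1
  | setNat (s : State) (x : ℕ) (i e : NatExp) :
      Exec (.setNat x i e) s (s.setNat x (i.eval s) (e.eval s)) (i.cost + e.cost + 1)
  | setNum (s : State) (x : ℕ) (i : NatExp) (e : NumExp) :
      Exec (.setNum x i e) s (s.setNum x (i.eval s) (e.eval s)) (i.cost + e.cost + 1)
  | seq {p p' : Program} {s s' s'' : State} {t t' : ℕ} :
      Exec p s s' t → Exec p' s' s'' t' → Exec (.seq p p') s s'' (t + t')
  | branch_true {b : Test} {p p' : Program} {s s' : State} {t : ℕ} :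
      b.Holds s → Exec p s s' t → Exec (.branch b p p') s s' (b.cost + t)
  | branch_false {b : Test} {p p' : Program} {s s' : State} {t : ℕ} :
      ¬ b.Holds s → Exec p' s s' t → Exec (.branch b p p') s s' (b.cost + t)
  | loop_true {b : Test} {p : Program} {s s' s'' : State} {t t' : ℕ} :
      b.Holds s → Exec p s s' t → Exec (.loop b p) s' s'' t' →
        Exec (.loop b p) s s'' (b.cost + t + t')
  | loop_false {b : Test} {p : Program} {s : State} :
      ¬ b.Holds s → Exec (.loop b p) s s b.cost

/-- The machine is deterministic: the input determines the result and the running time. -/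
theorem Exec.deterministic {p : Program} {s s₁ s₂ : State} {t₁ t₂ : ℕ}
    (h₁ : Exec p s s₁ t₁) (h₂ : Exec p s s₂ t₂) : s₁ = s₂ ∧ t₁ = t₂ := by
  induction h₁ generalizing s₂ t₂ with
  | skip | setNat | setNum => cases h₂; exact ⟨rfl, rfl⟩
  | seq _ _ ih ih' =>
    cases h₂ with
    | seq k k' =>
      obtain ⟨rfl, rfl⟩ := ih k
      obtain ⟨rfl, rfl⟩ := ih' k'
      exact ⟨rfl, rfl⟩
  | branch_true hb _ ih =>
    cases h₂ with
    | branch_true _ k => obtain ⟨rfl, rfl⟩ := ih k; exact ⟨rfl, rfl⟩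
    | branch_false hb' _ => exact absurd hb hb'
  | branch_false hb _ ih =>
    cases h₂ with
    | branch_true hb' _ => exact absurd hb' hb
    | branch_false _ k => obtain ⟨rfl, rfl⟩ := ih k; exact ⟨rfl, rfl⟩
  | loop_true hb _ _ ih ih' =>
    cases h₂ with
    | loop_true _ k k' =>
      obtain ⟨rfl, rfl⟩ := ih k
      obtain ⟨rfl, rfl⟩ := ih' k'
      exact ⟨rfl, rfl⟩
    | loop_false hb' => exact absurd hb hb'
  | loop_false hb =>
    cases h₂ with
    | loop_true hb' _ _ => exact absurd hb' hb
    | loop_false _ => exact ⟨rfl, rfl⟩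

/-- The initial memory. Arrays `0` and `1` of natural numbers hold `|V|` and `|E|` in their entry
`0`, arrays `2` and `3` hold the first and the second ends of the edges; entry `0` of the arrays
`0`, `1` and `2` of complex numbers holds `q`, `w` and `ε`. Everything else is `0`. -/
noncomputable def input {α β : Type*} {G : Graph α β} (L : G.EdgeList) (q w : ℂ) (ε : ℝ) :
    State where
  nat x i :=
    match x with
    | 0 => if i = 0 then L.n else 0
    | 1 => if i = 0 then L.m else 0
    | 2 => if h : i < L.m then (L.fst ⟨i, h⟩ : ℕ) else 0
    | 3 => if h : i < L.m then (L.snd ⟨i, h⟩ : ℕ) else 0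
    | _ => 0
  num x i :=
    match x with
    | 0 => if i = 0 then q else 0
    | 1 => if i = 0 then w else 0
    | 2 => if i = 0 then (ε : ℂ) else 0
    | _ => 0

/-- The result of a computation: entry `0` of the array `3` of complex numbers. -/
def State.output (s : State) : ℂ := s.num 3 0

end ComplexRAM

/-!
For an edge family `E` and a vertex `v` let `ratio E v` be the random-cluster sum of `E`, divided by
that of `E` with the edges at `v` deleted. Deletion and contraction of the edges between `v` and a
neighbour `u` express this ratio through those of three families with fewer live edges: `ratio =
ratio₀ + c * ratio₁ / ratio₂` with `c = ((1 + w) ^ j - 1) / q`. If `|q|` is large, then `c` is so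
small that, by induction on the number of edges, all ratios stay in a disc of radius at most `1 / 2`
around `1`; in particular the sums do not vanish. On this disc the recursion halves errors, so the
recursion tree can be truncated at depth `O(log (n / ε))`, where it has polynomially many nodes. The
sum itself is `q ^ n` times a telescoping product of `n` ratios.
-/

/-! ### The random-cluster sum of an edge family -/

namespace EdgeFamily

variable {ι V : Type*}

/-- The number of components of the graph on `V` with edges `E i`, `i ∈ A`. -/
noncomputable def comps (E : ι → V × V) (A : Finset ι) : ℕ :=
  Nat.card (Quot fun x y => ∃ i ∈ A, E i = (x, y))

theorem comps_congr {E E' : ι → V × V} {A : Finset ι} (h : ∀ i ∈ A, E i = E' i) :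
    comps E A = comps E' A := by
  have hrel : (fun x y => ∃ i ∈ A, E i = (x, y)) = fun x y => ∃ i ∈ A, E' i = (x, y) := by
    funext x y
    exact propext (exists_congr fun i => and_congr_right fun hi => by rw [h i hi])
  rw [comps, comps, hrel]

theorem comps_empty (E : ι → V × V) : comps E ∅ = Nat.card V :=
  Nat.card_congr
    { toFun := Quot.lift id fun _ _ ⟨i, hi, _⟩ => absurd hi (Finset.notMem_empty i)
      invFun := Quot.mk _
      left_inv := by rintro ⟨x⟩; rfl
      right_inv := fun _ => rfl }

theorem comps_union_of_loops [DecidableEq ι] {E : ι → V × V} (B : Finset ι) {C : Finset ι}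
    (hC : ∀ i ∈ C, (E i).1 = (E i).2) : comps E (B ∪ C) = comps E B := by
  refine Nat.card_congr
    { toFun := Quot.lift (Quot.mk _) ?_
      invFun := Quot.lift (Quot.mk _) ?_
      left_inv := by rintro ⟨x⟩; rfl
      right_inv := by rintro ⟨x⟩; rfl }
  · rintro x y ⟨i, hi, e⟩
    rcases Finset.mem_union.1 hi with hi | hi
    · exact Quot.sound ⟨i, hi, e⟩
    · have := hC i hi
      rw [e] at this
      exact congrArg _ this
  · rintro x y ⟨i, hi, e⟩
    exact Quot.sound ⟨i, Finset.mem_union_left _ hi, e⟩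

variable [DecidableEq V]

/-- The map that moves `u` to `v` and fixes every other vertex. -/
def relabel (u v x : V) : V := if x = u then v else x

theorem relabel_self (u v : V) : relabel u v u = v := if_pos rfl

theorem relabel_of_ne {u x : V} (v : V) (h : x ≠ u) : relabel u v x = x := if_neg h

theorem relabel_ne {u v : V} (huv : u ≠ v) (x : V) : relabel u v x ≠ u := by
  unfold relabel
  split_ifs with h
  · exact huv.symm
  · exact h

theorem quot_mk_relabel {r : V → V → Prop} {u v : V} (h : Quot.mk r u = Quot.mk r v) (x : V) :
    Quot.mk r (relabel u v x) = Quot.mk r x := by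
  rcases eq_or_ne x u with rfl | hx
  · rw [relabel_self, h]
  · rw [relabel_of_ne v hx]

/-- After the relabelling `u` is isolated, and the other classes are those of `r`. -/
theorem card_quot_map_relabel [Finite V] {r : V → V → Prop} {u v : V} (huv : u ≠ v)
    (h : Quot.mk r u = Quot.mk r v) :
    Nat.card (Quot (Relation.Map r (relabel u v) (relabel u v))) = Nat.card (Quot r) + 1 := by
  set r' := Relation.Map r (relabel u v) (relabel u v)
  rw [← Finite.card_option]
  refine Nat.card_congr
    { toFun := Quot.lift (fun x => if x = u then none else some (Quot.mk r x)) ?_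
      invFun := fun o => o.elim (Quot.mk r' u)
        (Quot.lift (fun x => Quot.mk r' (relabel u v x)) fun x y hxy =>
          Quot.sound ⟨x, y, hxy, rfl, rfl⟩)
      left_inv := ?_
      right_inv := ?_ }
  · rintro _ _ ⟨x, y, hxy, rfl, rfl⟩
    simp only [relabel_ne huv, if_false, quot_mk_relabel h, Quot.sound hxy]
  · rintro ⟨x⟩
    rcases eq_or_ne x u with rfl | hx
    · simp
    · simp [hx, relabel_of_ne]
  · rintro (_ | x)
    · simp
    · induction x using Quot.ind
      simp [relabel_ne huv, quot_mk_relabel h]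

/-- Contract `u` into `v`; the vertex `u` stays as an isolated vertex. -/
def mergeEdge (u v : V) (e : V × V) : V × V := (relabel u v e.1, relabel u v e.2)

/-- Turn an edge between `u` and `v` into a loop. Loops play the role of deleted edges. -/
def cutEdge (u v : V) (e : V × V) : V × V := if e = (u, v) ∨ e = (v, u) then (e.1, e.1) else e

/-- Turn an edge at `v` into a loop. -/
def removeEdge (v : V) (e : V × V) : V × V := if e.1 = v ∨ e.2 = v then (e.1, e.1) else e

/-- The edge family with `u` contracted into `v`. -/
def merge (u v : V) (E : ι → V × V) : ι → V × V := fun i => mergeEdge u v (E i)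

/-- The edge family with the edges between `u` and `v` deleted. -/
def cut (u v : V) (E : ι → V × V) : ι → V × V := fun i => cutEdge u v (E i)

/-- The edge family with the edges at `v` deleted. -/
def remove (v : V) (E : ι → V × V) : ι → V × V := fun i => removeEdge v (E i)

theorem cut_self (v : V) (E : ι → V × V) : cut v v E = E := by
  funext i
  simp only [cut, cutEdge]
  grind

theorem remove_cut (u v : V) (E : ι → V × V) : remove v (cut u v E) = remove v E := by
  funext i
  simp only [remove, removeEdge, cut, cutEdge]
  grind

variable [Fintype ι]

/-- The edges that are not loops. -/
def live (E : ι → V × V) : Finset ι := {i | (E i).1 ≠ (E i).2}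

/-- The edges that are not loops and have `v` as an end. -/
def liveAt (E : ι → V × V) (v : V) : Finset ι := {i ∈ live E | (E i).1 = v ∨ (E i).2 = v}

/-- The number of live edges at a vertex. -/
def liveDegree (E : ι → V × V) (v : V) : ℕ := (liveAt E v).card

/-- The live edges between `u` and `v`. -/
def between (u v : V) (E : ι → V × V) : Finset ι := {i ∈ live E | E i = (u, v) ∨ E i = (v, u)}

theorem mem_live {E : ι → V × V} {i : ι} : i ∈ live E ↔ (E i).1 ≠ (E i).2 := by simp [live]

theorem mem_liveAt {E : ι → V × V} {v : V} {i : ι} :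
    i ∈ liveAt E v ↔ (E i).1 ≠ (E i).2 ∧ ((E i).1 = v ∨ (E i).2 = v) := by
  simp [liveAt, mem_live]

theorem mem_between {u v : V} {E : ι → V × V} {i : ι} :
    i ∈ between u v E ↔ (E i).1 ≠ (E i).2 ∧ (E i = (u, v) ∨ E i = (v, u)) := by
  simp [between, mem_live]

theorem between_self (v : V) (E : ι → V × V) : between v v E = ∅ := by
  ext i
  simp only [mem_between, Finset.notMem_empty]
  grind

theorem ne_of_between_nonempty {u v : V} {E : ι → V × V} (h : (between u v E).Nonempty) :
    u ≠ v := by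
  rintro rfl
  simp [between_self] at h

theorem between_subset_liveAt_left (u v : V) (E : ι → V × V) : between u v E ⊆ liveAt E u := by
  intro i
  simp only [mem_between, mem_liveAt]
  grind

theorem card_between_le (u v : V) (E : ι → V × V) : (between u v E).card ≤ liveDegree E u :=
  Finset.card_le_card (between_subset_liveAt_left u v E)

section Live

variable [DecidableEq ι]

theorem live_merge (u v : V) (E : ι → V × V) : live (merge u v E) = live E \ between u v E := by
  ext i
  simp only [Finset.mem_sdiff, mem_live, mem_between, merge, mergeEdge, relabel]
  grind

theorem live_cut (u v : V) (E : ι → V × V) : live (cut u v E) = live E \ between u v E := by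
  ext i
  simp only [Finset.mem_sdiff, mem_live, mem_between, cut, cutEdge]
  grind

theorem live_remove (v : V) (E : ι → V × V) : live (remove v E) = live E \ liveAt E v := by
  ext i
  simp only [Finset.mem_sdiff, mem_live, mem_liveAt, remove, removeEdge]
  grind

end Live

theorem liveAt_cut_subset (u v x : V) (E : ι → V × V) : liveAt (cut u v E) x ⊆ liveAt E x := by
  intro i
  simp only [mem_liveAt, cut, cutEdge]
  grind

theorem liveDegree_cut_le (u v x : V) (E : ι → V × V) :
    liveDegree (cut u v E) x ≤ liveDegree E x :=
  Finset.card_le_card (liveAt_cut_subset u v x E)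

theorem liveDegree_cut_lt {u v : V} {E : ι → V × V} (h : (between u v E).Nonempty) :
    liveDegree (cut u v E) v < liveDegree E v := by
  obtain ⟨i, hi⟩ := h
  refine Finset.card_lt_card ((Finset.ssubset_iff_of_subset (liveAt_cut_subset u v v E)).2
    ⟨i, ?_, ?_⟩) <;>
  · simp only [mem_between, mem_liveAt, cut, cutEdge] at hi ⊢
    grind

theorem liveDegree_merge_self_le (u v : V) (E : ι → V × V) :
    liveDegree (merge u v E) v ≤ liveDegree E v + liveDegree E u := by
  classical
  refine (Finset.card_le_card fun i => ?_).trans (Finset.card_union_le _ _)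
  simp only [Finset.mem_union, mem_liveAt, merge, mergeEdge, relabel]
  grind

theorem liveDegree_merge_le {u v x : V} (hx : x ≠ v) (E : ι → V × V) :
    liveDegree (merge u v E) x ≤ liveDegree E x := by
  refine Finset.card_le_card fun i => ?_
  simp only [mem_liveAt, merge, mergeEdge, relabel]
  grind

theorem liveDegree_remove_le (v x : V) (E : ι → V × V) :
    liveDegree (remove v E) x ≤ liveDegree E x := by
  refine Finset.card_le_card fun i => ?_
  simp only [mem_liveAt, remove, removeEdge]
  grind

theorem liveDegree_remove_self (v : V) (E : ι → V × V) : liveDegree (remove v E) v = 0 := by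
  rw [liveDegree, Finset.card_eq_zero, Finset.eq_empty_iff_forall_notMem]
  intro i
  simp only [mem_liveAt, remove, removeEdge]
  grind

theorem card_live_cut_lt {u v : V} {E : ι → V × V} (h : (between u v E).Nonempty) :
    (live (cut u v E)).card < (live E).card := by
  classical
  rw [live_cut]
  exact Finset.card_lt_card (Finset.sdiff_ssubset (Finset.filter_subset _ _) h)

theorem card_live_merge_lt {u v : V} {E : ι → V × V} (h : (between u v E).Nonempty) :
    (live (merge u v E)).card < (live E).card := by
  classical
  rw [live_merge]
  exact Finset.card_lt_card (Finset.sdiff_ssubset (Finset.filter_subset _ _) h)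

theorem card_live_remove_lt {v : V} {E : ι → V × V} (h : (liveAt E v).Nonempty) :
    (live (remove v E)).card < (live E).card := by
  classical
  rw [live_remove]
  exact Finset.card_lt_card (Finset.sdiff_ssubset (Finset.filter_subset _ _) h)

/-- The sum of `q ^ k(A) * w ^ |A|` over the sets `A` of live edges. -/
noncomputable def clusterSum (q w : ℂ) (E : ι → V × V) : ℂ :=
  ∑ A ∈ (live E).powerset, q ^ comps E A * w ^ A.card

theorem clusterSum_congr (q w : ℂ) {E E' : ι → V × V} (hl : live E = live E')
    (h : ∀ i ∈ live E, E i = E' i) : clusterSum q w E = clusterSum q w E' := by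
  rw [clusterSum, clusterSum, ← hl]
  refine Finset.sum_congr rfl fun A hA => ?_
  rw [comps_congr fun i hi => h i (Finset.mem_powerset.1 hA hi)]

theorem clusterSum_of_live_eq_empty (q w : ℂ) {E : ι → V × V} (h : live E = ∅) :
    clusterSum q w E = q ^ Nat.card V := by
  simp [clusterSum, h, comps_empty]

theorem clusterSum_remove_of_liveDegree_eq_zero (q w : ℂ) {v : V} {E : ι → V × V}
    (h : liveDegree E v = 0) : clusterSum q w (remove v E) = clusterSum q w E := by
  classical
  have hl : live (remove v E) = live E := by
    rw [live_remove, Finset.card_eq_zero.1 h, Finset.sdiff_empty]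
  refine clusterSum_congr q w hl fun i hi => ?_
  simp only [mem_live, remove, removeEdge] at hi ⊢
  grind

theorem clusterSum_remove_merge (q w : ℂ) {u v : V} (huv : u ≠ v) (E : ι → V × V) :
    clusterSum q w (remove v (merge u v E)) = clusterSum q w (remove u (remove v E)) := by
  refine clusterSum_congr q w ?_ fun i hi => ?_
  · ext i
    simp only [mem_live, remove, removeEdge, merge, mergeEdge, relabel]
    grind
  · simp only [mem_live, remove, removeEdge, merge, mergeEdge, relabel] at hi ⊢
    grind

/-! ### Deletion and contraction -/

theorem comps_union_between [Finite V] [DecidableEq ι] {u v : V} (huv : u ≠ v) (E : ι → V × V)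
    (B : Finset ι) {C : Finset ι} (hC : C ⊆ between u v E) (hne : C.Nonempty) :
    comps E (B ∪ C) + 1 = comps (merge u v E) B := by
  set r : V → V → Prop := fun x y => ∃ i ∈ B ∪ C, E i = (x, y) with hr
  have hmap : (fun x y => ∃ i ∈ B ∪ C, merge u v E i = (x, y)) =
      Relation.Map r (relabel u v) (relabel u v) := by
    funext x y
    simp only [hr, Relation.Map, merge, mergeEdge, Prod.ext_iff, eq_iff_iff]
    grind
  have hjoin : Quot.mk r u = Quot.mk r v := by
    obtain ⟨i, hi⟩ := hne
    rcases (mem_between.1 (hC hi)).2 with e | e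
    · exact Quot.sound ⟨i, Finset.mem_union_right _ hi, e⟩
    · exact (Quot.sound ⟨i, Finset.mem_union_right _ hi, e⟩).symm
  have hloops : ∀ i ∈ C, (merge u v E i).1 = (merge u v E i).2 := by
    intro i hi
    have := mem_between.1 (hC hi)
    simp only [merge, mergeEdge, relabel]
    grind
  rw [← comps_union_of_loops B hloops, comps, comps, hmap, card_quot_map_relabel huv hjoin]

theorem sum_powerset_union {ι M : Type*} [DecidableEq ι] [AddCommMonoid M] {s t : Finset ι}
    (h : Disjoint s t) (f : Finset ι → M) :
    ∑ A ∈ (s ∪ t).powerset, f A = ∑ B ∈ s.powerset, ∑ C ∈ t.powerset, f (B ∪ C) := by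
  rw [Finset.powerset_union, ← Finset.image_sup_product, Finset.sum_image, Finset.sum_product]
  · rfl
  rintro ⟨B, C⟩ hBC ⟨B', C'⟩ hBC' e
  simp only [Finset.coe_product, Set.mem_prod, Finset.mem_coe, Finset.mem_powerset] at hBC hBC'
  have hsplit : ∀ i, i ∈ B ∨ i ∈ C ↔ i ∈ B' ∨ i ∈ C' := by
    simpa only [Finset.ext_iff, Function.uncurry_apply_pair, Finset.sup_eq_union, Finset.mem_union]
      using e
  rw [Finset.disjoint_left] at h
  simp only [Prod.mk.injEq, Finset.ext_iff]
  grind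

theorem sum_nonempty_powerset_pow_card {ι R : Type*} [DecidableEq ι] [CommRing R] (w : R)
    (s : Finset ι) :
    ∑ C ∈ s.powerset.erase ∅, w ^ C.card = (1 + w) ^ s.card - 1 := by
  have := Finset.sum_pow_mul_eq_add_pow w 1 s
  rw [← Finset.add_sum_erase _ _ (Finset.empty_mem_powerset s)] at this
  simp only [Finset.card_empty, pow_zero, one_pow, mul_one] at this
  rw [add_comm 1 w, ← this, add_sub_cancel_left]

/-- The weight of the contracted term in the recursion for the ratios. -/
noncomputable def contractWeight (q w : ℂ) (u v : V) (E : ι → V × V) : ℂ :=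
  ((1 + w) ^ (between u v E).card - 1) / q

/-- Deletion and contraction of all edges between `u` and `v` at once: a set `A` of live edges
either avoids them, or contains a nonempty set `C` of them that joins `u` to `v`. -/
theorem clusterSum_eq_cut_add_merge [Finite V] {q : ℂ} (hq : q ≠ 0) (w : ℂ) {u v : V}
    (huv : u ≠ v) (E : ι → V × V) :
    clusterSum q w E =
      clusterSum q w (cut u v E) + contractWeight q w u v E * clusterSum q w (merge u v E) := by
  classical
  set P := between u v E with hP
  have hPl : P ⊆ live E := Finset.filter_subset _ _
  have hd : Disjoint (live E \ P) P := Finset.sdiff_disjoint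
  have hcut : ∀ B ⊆ live E \ P, comps (cut u v E) B = comps E B := fun B hB =>
    comps_congr fun i hi => by
      have := hB hi
      simp only [hP, Finset.mem_sdiff, mem_live, mem_between, cut, cutEdge] at this ⊢
      grind
  have hmerge : ∀ B ⊆ live E \ P, ∀ C ∈ P.powerset.erase ∅,
      q ^ comps E (B ∪ C) * w ^ (B ∪ C).card =
        w ^ C.card * (q⁻¹ * (q ^ comps (merge u v E) B * w ^ B.card)) := fun B hB C hC => by
    rw [Finset.mem_erase, Finset.mem_powerset] at hC
    rw [← comps_union_between huv E B hC.2 (Finset.nonempty_iff_ne_empty.2 hC.1),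
      Finset.card_union_of_disjoint (hd.mono hB hC.2)]
    field_simp
    ring
  rw [clusterSum, ← Finset.sdiff_union_of_subset hPl, sum_powerset_union hd, clusterSum, clusterSum,
    live_cut, live_merge, ← hP, Finset.mul_sum, ← Finset.sum_add_distrib]
  refine Finset.sum_congr rfl fun B hB => ?_
  rw [Finset.mem_powerset] at hB
  rw [← Finset.add_sum_erase _ _ (Finset.empty_mem_powerset P), Finset.union_empty, hcut B hB,
    Finset.sum_congr rfl (hmerge B hB), ← Finset.sum_mul, sum_nonempty_powerset_pow_card,
    contractWeight, ← hP]
  ring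

/-- The ratio by which the cluster sum changes when the edges at `v` are restored. -/
noncomputable def ratio (q w : ℂ) (E : ι → V × V) (v : V) : ℂ :=
  clusterSum q w E / clusterSum q w (remove v E)

theorem ratio_of_liveDegree_eq_zero {q w : ℂ} {v : V} {E : ι → V × V} (h : liveDegree E v = 0)
    (h0 : clusterSum q w (remove v E) ≠ 0) : ratio q w E v = 1 := by
  rw [ratio, ← clusterSum_remove_of_liveDegree_eq_zero q w h, div_self h0]

theorem ratio_eq_cut_add_merge_div_remove [Finite V] {q w : ℂ} (hq : q ≠ 0) {u v : V} (huv : u ≠ v)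
    (E : ι → V × V) (h0 : clusterSum q w (remove v E) ≠ 0)
    (h1 : clusterSum q w (remove u (remove v E)) ≠ 0) :
    ratio q w E v = ratio q w (cut u v E) v +
      contractWeight q w u v E * ratio q w (merge u v E) v / ratio q w (remove v E) u := by
  simp only [ratio]
  rw [remove_cut, clusterSum_remove_merge q w huv, clusterSum_eq_cut_add_merge hq w huv E]
  field_simp

end EdgeFamily

namespace EdgeFamily

/-! ### Bounds for the ratios -/

/-- The radius of the disc around `1` that contains the ratio at a vertex of live degree `d`. -/
noncomputable def radius (Δ d : ℕ) : ℝ := (2 ^ d - 1) / 2 ^ (Δ + 1)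

theorem radius_nonneg (Δ d : ℕ) : 0 ≤ radius Δ d :=
  div_nonneg (sub_nonneg.2 (one_le_pow₀ one_le_two)) (by positivity)

theorem radius_zero (Δ : ℕ) : radius Δ 0 = 0 := by simp [radius]

theorem radius_le_half {Δ d : ℕ} (hd : d ≤ Δ) : radius Δ d ≤ 1 / 2 := by
  have h : (2 : ℝ) ^ d ≤ 2 ^ Δ := pow_le_pow_right₀ one_le_two hd
  rw [radius, div_le_div_iff₀ (by positivity) two_pos, pow_succ]
  linarith

theorem radius_le_two_pow (Δ d : ℕ) : radius Δ d ≤ 2 ^ d - 1 :=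
  div_le_self (sub_nonneg.2 (one_le_pow₀ one_le_two)) (one_le_pow₀ one_le_two)

theorem half_le_norm {Δ d : ℕ} (hd : d ≤ Δ) {x : ℂ} (h : ‖x - 1‖ ≤ radius Δ d) : 1 / 2 ≤ ‖x‖ := by
  have htri : ‖(1 : ℂ)‖ ≤ ‖x‖ + ‖x - 1‖ := by simpa using norm_sub_le x (x - 1)
  rw [norm_one] at htri
  linarith [radius_le_half hd]

theorem norm_le_two_pow {Δ d : ℕ} {x : ℂ} (h : ‖x - 1‖ ≤ radius Δ d) : ‖x‖ ≤ 2 ^ d := by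
  have htri := norm_add_le (x - 1) 1
  rw [sub_add_cancel, norm_one] at htri
  linarith [radius_le_two_pow Δ d]

/-- `q` is so large, compared to `w`, that the recursion for the ratios in graphs of maximum degree
`Δ` is a contraction. -/
structure IsContracting (q w : ℂ) (Δ : ℕ) : Prop where
  ne_zero : q ≠ 0
  norm_weight_le : ∀ j ≤ Δ, ‖((1 + w) ^ j - 1) / q‖ ≤ 1 / (32 * 16 ^ Δ)

theorem isContracting_of_lt {q w : ℂ} {Δ : ℕ} (hq : ((1 + ‖w‖) ^ Δ + 1) * (32 * 16 ^ Δ) < ‖q‖) :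
    IsContracting q w Δ := by
  have hq0 : 0 < ‖q‖ := lt_trans (by positivity) hq
  refine ⟨norm_pos_iff.1 hq0, fun j hj => ?_⟩
  have hj : ‖(1 + w) ^ j - 1‖ ≤ (1 + ‖w‖) ^ Δ + 1 :=
    calc ‖(1 + w) ^ j - 1‖ ≤ ‖1 + w‖ ^ j + 1 := by simpa using norm_sub_le ((1 + w) ^ j) 1
      _ ≤ (1 + ‖w‖) ^ j + 1 := by gcongr; simpa using norm_add_le 1 w
      _ ≤ (1 + ‖w‖) ^ Δ + 1 := by gcongr; linarith [norm_nonneg w]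
  rw [norm_div, div_le_div_iff₀ hq0 (by positivity), one_mul]
  exact (mul_le_mul_of_nonneg_right hj (by positivity)).trans hq.le

theorem norm_step_sub_one_le {Δ d d₁ d₂ d₃ : ℕ} {c x₁ x₂ x₃ : ℂ} (hd₁ : d₁ < d)
    (hd₂ : d₂ ≤ d + Δ) (hd₃ : d₃ ≤ Δ) (hc : ‖c‖ ≤ 1 / (32 * 16 ^ Δ))
    (h₁ : ‖x₁ - 1‖ ≤ radius Δ d₁) (h₂ : ‖x₂ - 1‖ ≤ radius Δ d₂) (h₃ : ‖x₃ - 1‖ ≤ radius Δ d₃) :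
    ‖x₁ + c * x₂ / x₃ - 1‖ ≤ radius Δ d := by
  have hx₃ := half_le_norm hd₃ h₃
  have hx₂ : ‖x₂‖ ≤ 2 ^ d * 2 ^ Δ := by
    rw [← pow_add]
    exact (norm_le_two_pow h₂).trans (pow_le_pow_right₀ one_le_two hd₂)
  have hpow : (2 : ℝ) ^ d₁ * 2 ≤ 2 ^ d := by
    rw [← pow_succ]; exact pow_le_pow_right₀ one_le_two hd₁
  have h16 : (2 : ℝ) ^ Δ * 2 ^ Δ ≤ 16 ^ Δ := by
    rw [← mul_pow]; exact pow_le_pow_left₀ (by norm_num) (by norm_num) _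
  have hquot : ‖c * x₂ / x₃‖ ≤ 2 ^ d / (4 * 2 ^ Δ) :=
    calc ‖c * x₂ / x₃‖ = ‖c‖ * ‖x₂‖ / ‖x₃‖ := by rw [norm_div, norm_mul]
      _ ≤ 1 / (32 * 16 ^ Δ) * (2 ^ d * 2 ^ Δ) / (1 / 2) := by gcongr
      _ ≤ 1 / (32 * (2 ^ Δ * 2 ^ Δ)) * (2 ^ d * 2 ^ Δ) / (1 / 2) := by gcongr
      _ = 2 ^ d / (16 * 2 ^ Δ) := by field_simp; norm_num
      _ ≤ 2 ^ d / (4 * 2 ^ Δ) := by gcongr; norm_num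
  rw [radius, pow_succ] at h₁ ⊢
  calc ‖x₁ + c * x₂ / x₃ - 1‖ = ‖(x₁ - 1) + c * x₂ / x₃‖ := by ring_nf
    _ ≤ (2 ^ d₁ - 1) / (2 ^ Δ * 2) + 2 ^ d / (4 * 2 ^ Δ) :=
      (norm_add_le _ _).trans (add_le_add h₁ hquot)
    _ ≤ (2 ^ d / 2 - 1) / (2 ^ Δ * 2) + 2 ^ d / (4 * 2 ^ Δ) := by gcongr; linarith
    _ = (2 ^ d - 1) / (2 ^ Δ * 2) := by field_simp; ring

theorem norm_div_sub_div_le {x x' y y' : ℂ} (hx : 1 / 2 ≤ ‖x'‖) (hy : 1 / 2 ≤ ‖y'‖) :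
    ‖x / x' - y / y'‖ ≤ 2 * ‖x - y‖ + 4 * ‖y‖ * ‖x' - y'‖ := by
  have hx0 : x' ≠ 0 := norm_pos_iff.1 (by linarith)
  have hy0 : y' ≠ 0 := norm_pos_iff.1 (by linarith)
  have hsplit : x / x' - y / y' = (x - y) / x' + y * (y' - x') / (x' * y') := by
    field_simp; ring
  calc ‖x / x' - y / y'‖ ≤ ‖x - y‖ / ‖x'‖ + ‖y‖ * ‖x' - y'‖ / (‖x'‖ * ‖y'‖) := by
        rw [hsplit, norm_sub_rev x' y', ← norm_div, ← norm_mul, ← norm_mul, ← norm_div]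
        exact norm_add_le _ _
    _ ≤ ‖x - y‖ / (1 / 2) + ‖y‖ * ‖x' - y'‖ / (1 / 2 * (1 / 2)) := by gcongr
    _ = 2 * ‖x - y‖ + 4 * ‖y‖ * ‖x' - y'‖ := by ring

theorem norm_step_sub_step_le {Δ d d₁ d₂ d₃ k : ℕ} {c x₁ x₂ x₃ y₁ y₂ y₃ : ℂ} (hd₁ : d₁ < d)
    (hd₂ : d₂ ≤ d + Δ) (hd₃ : d₃ ≤ Δ) (hc : ‖c‖ ≤ 1 / (32 * 16 ^ Δ))
    (hy₂ : ‖y₂ - 1‖ ≤ radius Δ d₂) (hy₃ : ‖y₃ - 1‖ ≤ radius Δ d₃) (hx₃ : ‖x₃ - 1‖ ≤ radius Δ d₃)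
    (h₁ : ‖x₁ - y₁‖ ≤ 4 ^ d₁ / 2 ^ k) (h₂ : ‖x₂ - y₂‖ ≤ 4 ^ d₂ / 2 ^ k)
    (h₃ : ‖x₃ - y₃‖ ≤ 4 ^ d₃ / 2 ^ k) :
    ‖(x₁ + c * x₂ / x₃) - (y₁ + c * y₂ / y₃)‖ ≤ 4 ^ d / 2 ^ (k + 1) := by
  have b₁ : (4 : ℝ) ^ d₁ ≤ 4 ^ d / 4 := by
    rw [le_div_iff₀ (by norm_num), ← pow_succ]; exact pow_le_pow_right₀ (by norm_num) hd₁
  have b₂ : (4 : ℝ) ^ d₂ ≤ 4 ^ d * 4 ^ Δ := by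
    rw [← pow_add]; exact pow_le_pow_right₀ (by norm_num) hd₂
  have b₃ : (4 : ℝ) ^ d₃ ≤ 4 ^ Δ := pow_le_pow_right₀ (by norm_num) hd₃
  have hy : ‖y₂‖ ≤ 4 ^ d * 4 ^ Δ :=
    (norm_le_two_pow hy₂).trans ((pow_le_pow_left₀ (by norm_num) (by norm_num) _).trans b₂)
  have hΔ : (1 : ℝ) ≤ 4 ^ Δ := one_le_pow₀ (by norm_num)
  have h16 : (16 : ℝ) ^ Δ = 4 ^ Δ * 4 ^ Δ := by rw [← mul_pow]; norm_num
  have hquot : ‖x₂ / x₃ - y₂ / y₃‖ ≤ 6 * (4 ^ d * 16 ^ Δ / 2 ^ k) :=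
    calc _ ≤ 2 * ‖x₂ - y₂‖ + 4 * ‖y₂‖ * ‖x₃ - y₃‖ :=
          norm_div_sub_div_le (half_le_norm hd₃ hx₃) (half_le_norm hd₃ hy₃)
      _ ≤ 2 * (4 ^ d * 4 ^ Δ / 2 ^ k) + 4 * (4 ^ d * 4 ^ Δ) * (4 ^ Δ / 2 ^ k) := by
        gcongr
        · exact h₂.trans (by gcongr)
        · exact h₃.trans (by gcongr)
      _ ≤ 2 * (4 ^ d * (4 ^ Δ * 4 ^ Δ) / 2 ^ k) + 4 * (4 ^ d * 4 ^ Δ) * (4 ^ Δ / 2 ^ k) := by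
        gcongr; exact le_mul_of_one_le_right (by positivity) hΔ
      _ = 6 * (4 ^ d * 16 ^ Δ / 2 ^ k) := by rw [h16]; ring
  calc ‖(x₁ + c * x₂ / x₃) - (y₁ + c * y₂ / y₃)‖
      = ‖(x₁ - y₁) + c * (x₂ / x₃ - y₂ / y₃)‖ := by ring_nf
    _ ≤ ‖x₁ - y₁‖ + ‖c‖ * ‖x₂ / x₃ - y₂ / y₃‖ := by rw [← norm_mul]; exact norm_add_le _ _
    _ ≤ 4 ^ d / 4 / 2 ^ k + 1 / (32 * 16 ^ Δ) * (6 * (4 ^ d * 16 ^ Δ / 2 ^ k)) := by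
        gcongr; exact h₁.trans (by gcongr)
    _ = 4 ^ d / 2 ^ k * (7 / 16) := by field_simp; norm_num
    _ ≤ 4 ^ d / 2 ^ k * (1 / 2) := mul_le_mul_of_nonneg_left (by norm_num) (by positivity)
    _ = 4 ^ d / 2 ^ (k + 1) := by rw [pow_succ]; ring

variable {ι V : Type*} [DecidableEq V] [Fintype ι]

/-- All vertices but `v` have at most `Δ` live edges; `v` may have more, because contractions into
`v` increase its degree. -/
def DegreeLEAwayFrom (Δ : ℕ) (E : ι → V × V) (v : V) : Prop := ∀ x ≠ v, liveDegree E x ≤ Δ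

namespace DegreeLEAwayFrom

variable {Δ : ℕ} {E : ι → V × V} {v : V}

theorem cut (h : DegreeLEAwayFrom Δ E v) (u : V) : DegreeLEAwayFrom Δ (cut u v E) v :=
  fun x hx => (liveDegree_cut_le _ _ _ _).trans (h x hx)

theorem merge (h : DegreeLEAwayFrom Δ E v) (u : V) : DegreeLEAwayFrom Δ (merge u v E) v :=
  fun x hx => (liveDegree_merge_le hx _).trans (h x hx)

theorem liveDegree_remove_le (h : DegreeLEAwayFrom Δ E v) (x : V) :
    liveDegree (EdgeFamily.remove v E) x ≤ Δ := by
  rcases eq_or_ne x v with rfl | hx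
  · rw [liveDegree_remove_self]; exact Nat.zero_le _
  · exact (EdgeFamily.liveDegree_remove_le _ _ _).trans (h x hx)

theorem remove (h : DegreeLEAwayFrom Δ E v) (u : V) : DegreeLEAwayFrom Δ (remove v E) u :=
  fun x _ => h.liveDegree_remove_le x

theorem liveDegree_merge_le {u : V} (h : DegreeLEAwayFrom Δ E v) (hu : u ≠ v) :
    liveDegree (EdgeFamily.merge u v E) v ≤ liveDegree E v + Δ :=
  (liveDegree_merge_self_le u v E).trans (Nat.add_le_add_left (h u hu) _)

theorem norm_contractWeight_le {q w : ℂ} (h : DegreeLEAwayFrom Δ E v) (hq : IsContracting q w Δ)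
    {u : V} (hu : u ≠ v) : ‖contractWeight q w u v E‖ ≤ 1 / (32 * 16 ^ Δ) :=
  hq.norm_weight_le _ ((card_between_le u v E).trans (h u hu))

end DegreeLEAwayFrom

/-- The ratio of `E` at `v` is well defined and lies in the disc given by the degree of `v`. -/
structure RatioNearOne (q w : ℂ) (Δ : ℕ) (E : ι → V × V) (v : V) : Prop where
  clusterSum_remove_ne_zero : clusterSum q w (remove v E) ≠ 0
  norm_ratio_sub_one_le : ‖ratio q w E v - 1‖ ≤ radius Δ (liveDegree E v)

theorem half_le_norm_ratio {q w : ℂ} {Δ : ℕ} {E : ι → V × V} {v : V} (h : RatioNearOne q w Δ E v)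
    (hv : liveDegree E v ≤ Δ) : 1 / 2 ≤ ‖ratio q w E v‖ :=
  half_le_norm hv h.norm_ratio_sub_one_le

theorem clusterSum_ne_zero_of_ratioNearOne {q w : ℂ} {Δ : ℕ} {E : ι → V × V} {v : V}
    (h : RatioNearOne q w Δ E v) (hv : liveDegree E v ≤ Δ) : clusterSum q w E ≠ 0 := by
  intro h0
  have := half_le_norm_ratio h hv
  rw [ratio, h0, zero_div, norm_zero] at this
  linarith

theorem exists_between_nonempty {v : V} {E : ι → V × V} (h : (liveAt E v).Nonempty) :
    ∃ u, (between u v E).Nonempty := by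
  obtain ⟨i, hi⟩ := h
  rw [mem_liveAt] at hi
  rcases hi.2 with e | e
  · exact ⟨(E i).2, i, mem_between.2 ⟨hi.1, .inr (by rw [← e])⟩⟩
  · exact ⟨(E i).1, i, mem_between.2 ⟨hi.1, .inl (by rw [← e])⟩⟩

theorem ratioNearOne_of_between_nonempty [Finite V] {q w : ℂ} {Δ : ℕ} (hq : IsContracting q w Δ)
    {E : ι → V × V} {u v : V} (hE : DegreeLEAwayFrom Δ E v) (hu : (between u v E).Nonempty)
    (h₁ : RatioNearOne q w Δ (cut u v E) v) (h₂ : RatioNearOne q w Δ (merge u v E) v)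
    (h₃ : RatioNearOne q w Δ (remove v E) u) : RatioNearOne q w Δ E v := by
  have huv := ne_of_between_nonempty hu
  have h0 := clusterSum_ne_zero_of_ratioNearOne h₃ (hE.liveDegree_remove_le u)
  refine ⟨h0, ?_⟩
  rw [ratio_eq_cut_add_merge_div_remove hq.ne_zero huv E h0 h₃.clusterSum_remove_ne_zero]
  exact norm_step_sub_one_le (liveDegree_cut_lt hu) (hE.liveDegree_merge_le huv)
    (hE.liveDegree_remove_le u) (hE.norm_contractWeight_le hq huv) h₁.norm_ratio_sub_one_le
    h₂.norm_ratio_sub_one_le h₃.norm_ratio_sub_one_le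

theorem ratioNearOne [Finite V] {q w : ℂ} {Δ : ℕ} (hq : IsContracting q w Δ) (E : ι → V × V) (v : V)
    (hE : DegreeLEAwayFrom Δ E v) : RatioNearOne q w Δ E v := by
  induction hN : (live E).card using Nat.strong_induction_on generalizing E v with
  | _ N ih =>
  subst hN
  have hstep : ∀ v, DegreeLEAwayFrom Δ E v → (liveAt E v).Nonempty → RatioNearOne q w Δ E v := by
    intro v hE hv
    obtain ⟨u, hu⟩ := exists_between_nonempty hv
    exact ratioNearOne_of_between_nonempty hq hE hu
      (ih _ (card_live_cut_lt hu) _ v (hE.cut u) rfl)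
      (ih _ (card_live_merge_lt hu) _ v (hE.merge u) rfl)
      (ih _ (card_live_remove_lt hv) _ u (hE.remove u) rfl)
  rcases (liveAt E v).eq_empty_or_nonempty with hv | hv
  · have hv : liveDegree E v = 0 := Finset.card_eq_zero.2 hv
    have hall : ∀ x, liveDegree E x ≤ Δ := fun x => by
      rcases eq_or_ne x v with rfl | hx
      · rw [hv]; exact Nat.zero_le _
      · exact hE x hx
    have h0 : clusterSum q w E ≠ 0 := by
      rcases (live E).eq_empty_or_nonempty with he | ⟨i, hi⟩
      · rw [clusterSum_of_live_eq_empty q w he]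
        exact pow_ne_zero _ hq.ne_zero
      · exact clusterSum_ne_zero_of_ratioNearOne (hstep (E i).1 (fun x _ => hall x)
          ⟨i, mem_liveAt.2 ⟨mem_live.1 hi, .inl rfl⟩⟩) (hall _)
    rw [← clusterSum_remove_of_liveDegree_eq_zero q w hv] at h0
    exact ⟨h0, by rw [ratio_of_liveDegree_eq_zero hv h0, hv, radius_zero]; simp⟩
  · exact hstep v hE hv

end EdgeFamily

namespace EdgeFamily

/-! ### The truncated recursion -/

variable {m : ℕ} {V : Type*} [DecidableEq V]

/-- The end of `e` other than `v`; the default value `u` if `e` is a loop or not an edge at `v`. -/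
def otherEnd (v u : V) (e : V × V) : V :=
  if e.1 = v then if e.2 = v then u else e.2 else if e.2 = v then e.1 else u

theorem foldl_otherEnd_eq_or_mem (v : V) (l : List (V × V)) :
    l.foldl (otherEnd v) v = v ∧ (∀ e ∈ l, e.1 = v ∨ e.2 = v → e.1 = e.2) ∨
      l.foldl (otherEnd v) v ≠ v ∧
        ((l.foldl (otherEnd v) v, v) ∈ l ∨ (v, l.foldl (otherEnd v) v) ∈ l) := by
  induction l using List.reverseRecOn with
  | nil => simp
  | append_singleton l e ih =>
    obtain ⟨a, b⟩ := e
    simp only [List.foldl_append, List.foldl_cons, List.foldl_nil, List.mem_append,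
      List.mem_singleton, Prod.mk.injEq]
    generalize l.foldl (otherEnd v) v = u at ih ⊢
    simp only [otherEnd]
    grind

/-- A neighbour of `v`, found by a scan through the edges; `v` itself if `v` is isolated. -/
def neighbour (E : Fin m → V × V) (v : V) : V := (List.ofFn E).foldl (otherEnd v) v

theorem neighbour_of_liveAt_eq_empty {E : Fin m → V × V} {v : V} (h : liveAt E v = ∅) :
    neighbour E v = v := by
  rcases foldl_otherEnd_eq_or_mem v (List.ofFn E) with ⟨hu, -⟩ | ⟨hu, hmem⟩
  · exact hu
  · rw [Finset.eq_empty_iff_forall_notMem] at h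
    simp only [mem_liveAt, List.mem_ofFn] at h hmem
    grind

theorem between_neighbour_nonempty {E : Fin m → V × V} {v : V} (h : (liveAt E v).Nonempty) :
    (between (neighbour E v) v E).Nonempty := by
  obtain ⟨i, hi⟩ := h
  rw [mem_liveAt] at hi
  rcases foldl_otherEnd_eq_or_mem v (List.ofFn E) with ⟨-, hall⟩ | ⟨hu, hmem⟩
  · exact absurd (hall (E i) (List.mem_ofFn.2 ⟨i, rfl⟩) hi.2) hi.1
  · rcases hmem with hmem | hmem <;> obtain ⟨j, hj⟩ := List.mem_ofFn.1 hmem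
    · exact ⟨j, mem_between.2 ⟨by rw [hj]; exact hu, .inl hj⟩⟩
    · exact ⟨j, mem_between.2 ⟨by rw [hj]; exact hu.symm, .inr hj⟩⟩

/-- A node of the recursion tree for the ratios: an edge family with a distinguished vertex. -/
structure Node (m : ℕ) (V : Type*) where
  edges : Fin m → V × V
  vertex : V

namespace Node

/-- The neighbour whose edges to the distinguished vertex are cut and contracted. At an isolated
vertex this is the vertex itself, which makes the recursion trivial there. -/
def neighbour (N : Node m V) : V := EdgeFamily.neighbour N.edges N.vertex

/-- The three children of a node: delete, contract, and remove the distinguished vertex. -/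
def child (N : Node m V) : ℕ → Node m V
  | 0 => ⟨cut N.neighbour N.vertex N.edges, N.vertex⟩
  | 1 => ⟨merge N.neighbour N.vertex N.edges, N.vertex⟩
  | _ => ⟨remove N.vertex N.edges, N.neighbour⟩

/-- The weight of the contracted term in the recursion at a node. -/
noncomputable def weight (q w : ℂ) (N : Node m V) : ℂ :=
  contractWeight q w N.neighbour N.vertex N.edges

/-- The value obtained by unfolding the recursion for the ratio to depth `k`. -/
noncomputable def approxRatio (q w : ℂ) : ℕ → Node m V → ℂ
  | 0, _ => 1
  | k + 1, N => approxRatio q w k (N.child 0) +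
      N.weight q w * approxRatio q w k (N.child 1) / approxRatio q w k (N.child 2)

theorem approxRatio_of_liveAt_eq_empty (q w : ℂ) (k : ℕ) {N : Node m V}
    (h : liveAt N.edges N.vertex = ∅) : approxRatio q w k N = 1 := by
  induction k with
  | zero => rfl
  | succ k ih =>
    have hu : N.neighbour = N.vertex := neighbour_of_liveAt_eq_empty h
    have hcut : N.child 0 = N := by rw [child, hu, cut_self]
    have hweight : N.weight q w = 0 := by simp [weight, contractWeight, hu, between_self]
    rw [approxRatio, hcut, hweight, ih, zero_mul, zero_div, add_zero]

variable {q w : ℂ} {Δ : ℕ}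

theorem norm_approxRatio_sub_one_le (hq : IsContracting q w Δ) (k : ℕ) (N : Node m V)
    (hN : DegreeLEAwayFrom Δ N.edges N.vertex) :
    ‖approxRatio q w k N - 1‖ ≤ radius Δ (liveDegree N.edges N.vertex) := by
  induction k generalizing N with
  | zero => simpa [approxRatio] using radius_nonneg _ _
  | succ k ih =>
    rcases (liveAt N.edges N.vertex).eq_empty_or_nonempty with h | h
    · simpa [approxRatio_of_liveAt_eq_empty q w _ h] using radius_nonneg _ _
    · have hu := between_neighbour_nonempty h
      have huv := ne_of_between_nonempty hu
      exact norm_step_sub_one_le (liveDegree_cut_lt hu) (hN.liveDegree_merge_le huv)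
        (hN.liveDegree_remove_le _) (hN.norm_contractWeight_le hq huv) (ih _ (hN.cut _))
        (ih _ (hN.merge _)) (ih _ (hN.remove _))

theorem norm_approxRatio_sub_ratio_le [Finite V] (hq : IsContracting q w Δ) (k : ℕ) (N : Node m V)
    (hN : DegreeLEAwayFrom Δ N.edges N.vertex) :
    ‖approxRatio q w k N - ratio q w N.edges N.vertex‖ ≤
      4 ^ liveDegree N.edges N.vertex / 2 ^ k := by
  have near (E : Fin m → V × V) (v : V) := ratioNearOne hq E v
  induction k generalizing N with
  | zero =>
    have hpow : (2 : ℝ) ^ liveDegree N.edges N.vertex ≤ 4 ^ liveDegree N.edges N.vertex :=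
      pow_le_pow_left₀ (by norm_num) (by norm_num) _
    rw [approxRatio, norm_sub_rev, pow_zero, div_one]
    linarith [(near _ _ hN).norm_ratio_sub_one_le,
      radius_le_two_pow Δ (liveDegree N.edges N.vertex)]
  | succ k ih =>
    rcases (liveAt N.edges N.vertex).eq_empty_or_nonempty with h | h
    · rw [approxRatio_of_liveAt_eq_empty q w _ h, ratio_of_liveDegree_eq_zero
        (Finset.card_eq_zero.2 h) (near _ _ hN).clusterSum_remove_ne_zero, sub_self, norm_zero]
      positivity
    · have hu := between_neighbour_nonempty h
      have huv := ne_of_between_nonempty hu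
      rw [ratio_eq_cut_add_merge_div_remove hq.ne_zero huv _ (near _ _ hN).clusterSum_remove_ne_zero
        (near _ _ (hN.remove _)).clusterSum_remove_ne_zero]
      exact norm_step_sub_step_le (liveDegree_cut_lt hu) (hN.liveDegree_merge_le huv)
        (hN.liveDegree_remove_le _) (hN.norm_contractWeight_le hq huv)
        (near _ _ (hN.merge _)).norm_ratio_sub_one_le (near _ _ (hN.remove _)).norm_ratio_sub_one_le
        (norm_approxRatio_sub_one_le hq k _ (hN.remove _)) (ih _ (hN.cut _)) (ih _ (hN.merge _))
        (ih _ (hN.remove _))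

/-! ### The recursion tree as a heap -/

/-- The recursion tree below `root`, laid out in an array: the children of the node `i` are the
nodes `3 * i + 1`, `3 * i + 2` and `3 * i + 3`. -/
def heap (root : Node m V) : ℕ → Node m V
  | 0 => root
  | i + 1 => (heap root (i / 3)).child (i % 3)

theorem heap_child (root : Node m V) (i : ℕ) {r : ℕ} (hr : r < 3) :
    heap root (3 * i + r + 1) = (heap root i).child r := by
  rw [heap, show (3 * i + r) / 3 = i by omega, show (3 * i + r) % 3 = r by omega]

/-- The number of the first node at distance `k` from the root. -/
def levelStart : ℕ → ℕ
  | 0 => 0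
  | k + 1 => 3 * levelStart k + 1

theorem levelStart_lt_three_pow (k : ℕ) : levelStart k < 3 ^ k := by
  induction k with
  | zero => simp [levelStart]
  | succ k ih => rw [levelStart, pow_succ]; omega

theorem levelStart_mono : Monotone levelStart :=
  monotone_nat_of_le_succ fun k => by rw [levelStart]; omega

/-- The value at the node `i` of the recursion with the nodes `M`, `M + 1`, … as leaves. -/
noncomputable def heapValue (q w : ℂ) (root : Node m V) (M i : ℕ) : ℂ :=
  if i < M then heapValue q w root M (3 * i + 1) + (heap root i).weight q w *
    heapValue q w root M (3 * i + 2) / heapValue q w root M (3 * i + 3)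
  else 1
termination_by M - i

theorem heapValue_levelStart_add (q w : ℂ) (root : Node m V) (k : ℕ) {j i : ℕ}
    (hi : levelStart j ≤ i) (hi' : i < levelStart (j + 1)) :
    heapValue q w root (levelStart (j + k)) i = approxRatio q w k (heap root i) := by
  induction k generalizing i j with
  | zero => rw [Nat.add_zero, heapValue, if_neg (not_lt.2 hi), approxRatio]
  | succ k ih =>
    have hchild {r : ℕ} (hr : r < 3) : heapValue q w root (levelStart (j + (k + 1)))
        (3 * i + r + 1) = approxRatio q w k ((heap root i).child r) := by
      rw [← heap_child root i hr, add_comm k, ← add_assoc]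
      exact ih (by rw [levelStart]; omega) (by rw [levelStart]; omega)
    rw [heapValue, if_pos (hi'.trans_le (levelStart_mono (by omega))), approxRatio,
      ← hchild (r := 0) (by norm_num), ← hchild (r := 1) (by norm_num),
      ← hchild (r := 2) (by norm_num)]

theorem heapValue_levelStart (q w : ℂ) (root : Node m V) (k : ℕ) :
    heapValue q w root (levelStart k) 0 = approxRatio q w k root := by
  have h := heapValue_levelStart_add q w root k (j := 0) (i := 0) le_rfl (by simp [levelStart])
  rwa [Nat.zero_add, heap] at h

end Node

end EdgeFamily

/-! ### Edge lists of multigraphs -/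

namespace EdgeFamily

section EdgeList

variable {α β : Type*} {G : Graph α β} (L : G.EdgeList)

/-- The edge family of an edge list. -/
def ends : Fin L.m → Fin L.n × Fin L.n := fun i => (L.fst i, L.snd i)

/-- The set of edges with the given numbers. -/
def edgeSet (A : Finset (Fin L.m)) : Set β := (fun i => (L.edge i : β)) '' A

theorem edge_injective : Function.Injective fun i => (L.edge i : β) :=
  Subtype.val_injective.comp L.edge.injective

theorem numComponents_restrict_edgeSet (A : Finset (Fin L.m)) :
    (G.restrict (edgeSet L A)).numComponents = comps (ends L) A := by
  set r : V(G) → V(G) → Prop := fun x y => (G.restrict (edgeSet L A)).Adj x.1 y.1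
  set r' : Fin L.n → Fin L.n → Prop := fun x y => ∃ i ∈ A, ends L i = (x, y)
  change Nat.card (Quot r) = Nat.card (Quot r')
  refine Nat.card_congr
    { toFun := Quot.lift (fun x => Quot.mk r' (L.vert.symm x)) ?_
      invFun := Quot.lift (fun x => Quot.mk r (L.vert x)) ?_
      left_inv := ?_
      right_inv := ?_ }
  · rintro x y ⟨e, he⟩
    rw [Graph.restrict_isLink] at he
    obtain ⟨⟨i, hi, rfl⟩, he⟩ := he
    have hi' : Quot.mk r' (L.fst i) = Quot.mk r' (L.snd i) := Quot.sound ⟨i, hi, rfl⟩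
    rcases he.eq_and_eq_or_eq_and_eq (L.isLink i) with ⟨hx, hy⟩ | ⟨hx, hy⟩ <;>
      rw [Subtype.val_inj] at hx hy <;> subst hx hy <;> simp [hi']
  · rintro x y ⟨i, hi, e⟩
    refine Quot.sound ⟨L.edge i, ?_⟩
    rw [Graph.restrict_isLink]
    cases e
    exact ⟨⟨i, hi, rfl⟩, L.isLink i⟩
  · rintro ⟨x⟩
    exact congrArg (Quot.mk r) (L.vert.apply_symm_apply x)
  · rintro ⟨x⟩
    exact congrArg (Quot.mk r') (L.vert.symm_apply_apply x)

theorem live_ends (hG : G.Loopless) : live (ends L) = Finset.univ := by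
  refine Finset.filter_true_of_mem fun i _ (h : L.fst i = L.snd i) => ?_
  have hlink := L.isLink i
  rw [h] at hlink
  exact hG.not_isLoopAt _ _ hlink

theorem tutte_eq_clusterSum (hG : G.Loopless) (q w : ℂ) :
    G.tutte q w = clusterSum q w (ends L) := by
  rw [Graph.tutte, clusterSum, live_ends L hG, ← finsum_mem_coe_finset]
  symm
  refine finsum_mem_eq_of_bijOn (edgeSet L) ⟨?_, ?_, ?_⟩ fun A _ => ?_
  · rintro A - _ ⟨i, -, rfl⟩
    exact (L.edge i).2
  · exact fun A _ A' _ h => Finset.coe_injective (Set.image_injective.2 (edge_injective L) h)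
  · intro B hB
    classical
    refine ⟨Finset.univ.filter fun i => (L.edge i : β) ∈ B, by simp, Set.Subset.antisymm ?_ ?_⟩
    · rintro _ ⟨i, hi, rfl⟩
      simpa using hi
    · exact fun e he => ⟨L.edge.symm ⟨e, hB he⟩, by simpa using he, by simp⟩
  · rw [numComponents_restrict_edgeSet, edgeSet, Set.ncard_image_of_injective _ (edge_injective L),
      Set.ncard_coe_finset]

theorem liveDegree_ends_le (v : Fin L.n) : liveDegree (ends L) v ≤ G.degree (L.vert v) := by
  have : Finite E(G) := Finite.of_equiv _ L.edge
  rw [liveDegree, ← Set.ncard_coe_finset, Graph.degree,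
    ← Set.ncard_image_of_injective _ (edge_injective L)]
  refine le_add_right (Set.ncard_le_ncard ?_ ?_)
  · rintro _ ⟨i, hi, rfl⟩
    rw [Graph.mem_incidenceSet]
    rcases (mem_liveAt.1 hi).2 with rfl | rfl
    · exact (L.isLink i).inc_left
    · exact (L.isLink i).inc_right
  · exact (Set.toFinite E(G)).subset fun e he => Graph.Inc.edge_mem he

theorem ncard_vertexSet : V(G).ncard = L.n := by
  rw [← Nat.card_coe_set_eq, ← Nat.card_congr L.vert, Nat.card_eq_fintype_card, Fintype.card_fin]

end EdgeList

theorem card_live_le {ι V : Type*} [Fintype ι] [Fintype V] [DecidableEq V] {Δ : ℕ}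
    {E : ι → V × V} (hE : ∀ v, liveDegree E v ≤ Δ) : (live E).card ≤ Δ * Fintype.card V := by
  refine (Finset.card_le_mul_card_image (f := fun i => (E i).1) (live E) Δ fun v _ =>
    (Finset.card_le_card fun i hi => ?_).trans (hE v)).trans
      (Nat.mul_le_mul_left _ (Finset.card_le_univ _))
  rw [Finset.mem_filter] at hi
  exact Finset.mem_filter.2 ⟨hi.1, .inl hi.2⟩

/-! ### Approximation of the random-cluster sum -/

section Product

variable {m n : ℕ}

/-- The edge family with the edges at the vertices below `i` deleted. -/
def dropBelow (i : ℕ) (E : Fin m → Fin n × Fin n) : Fin m → Fin n × Fin n :=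
  fun j => if i ≤ (E j).1 ∧ i ≤ (E j).2 then E j else ((E j).1, (E j).1)

theorem dropBelow_zero (E : Fin m → Fin n × Fin n) : dropBelow 0 E = E := by
  funext j; simp [dropBelow]

theorem remove_dropBelow (E : Fin m → Fin n × Fin n) (i : Fin n) :
    remove i (dropBelow i E) = dropBelow (i + 1) E := by
  funext j
  simp only [remove, removeEdge, dropBelow, Fin.ext_iff]
  grind

theorem clusterSum_dropBelow_all (q w : ℂ) (E : Fin m → Fin n × Fin n) :
    clusterSum q w (dropBelow n E) = q ^ n := by
  rw [clusterSum_of_live_eq_empty, Nat.card_eq_fintype_card, Fintype.card_fin]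
  refine Finset.filter_eq_empty_iff.2 fun j _ => ?_
  rw [dropBelow, if_neg fun h => absurd (E j).1.2 h.1.not_gt]
  simp

theorem liveDegree_dropBelow_le (i : ℕ) (E : Fin m → Fin n × Fin n) (x : Fin n) :
    liveDegree (dropBelow i E) x ≤ liveDegree E x := by
  refine Finset.card_le_card fun j => ?_
  simp only [mem_liveAt, dropBelow]
  grind

theorem clusterSum_eq_prod_ratio {q w : ℂ} (E : Fin m → Fin n × Fin n)
    (h : ∀ i : Fin n, clusterSum q w (remove i (dropBelow i E)) ≠ 0) :
    clusterSum q w E = ∏ i : Fin n, q * ratio q w (dropBelow i E) i := by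
  have telescope : ∀ k ≤ n, clusterSum q w E = (∏ i ∈ Finset.range k,
      clusterSum q w (dropBelow i E) / clusterSum q w (dropBelow (i + 1) E)) *
        clusterSum q w (dropBelow k E) := by
    intro k hk
    induction k with
    | zero => simp [dropBelow_zero]
    | succ k ih =>
      have hk' := h ⟨k, hk⟩
      rw [remove_dropBelow] at hk'
      rw [ih (Nat.le_of_succ_le hk), Finset.prod_range_succ, mul_assoc, div_mul_cancel₀ _ hk']
  rw [telescope n le_rfl, clusterSum_dropBelow_all, Finset.prod_mul_distrib, Finset.prod_const,
    Finset.card_univ, Fintype.card_fin, mul_comm, Finset.prod_range]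
  simp only [ratio, remove_dropBelow]

end Product

end EdgeFamily

theorem isMultApprox_of_norm_le {ε : ℝ} {z ξ : ℂ} (hz : z ≠ 0)
    (h : ‖ξ / z - 1‖ ≤ min ε 1 / 4) : IsMultApprox ε z ξ := by
  have hhalf : ‖ξ / z - 1‖ ≤ 1 / 2 := by linarith [min_le_right ε 1]
  have hξ : ξ ≠ 0 := by
    rintro rfl
    norm_num at hhalf
  have hlog : ‖Complex.log (ξ / z)‖ ≤ ε := by
    have hle := Complex.norm_log_one_add_half_le_self hhalf
    rw [add_sub_cancel] at hle
    linarith [min_le_left ε 1, norm_nonneg (ξ / z - 1)]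
  have hre := (Complex.abs_re_le_norm _).trans hlog
  have him := (Complex.abs_im_le_norm _).trans hlog
  rw [Complex.log_im] at him
  rw [Complex.log_re, abs_le] at hre
  have hnorm : ‖z‖ / ‖ξ‖ = Real.exp (-Real.log ‖ξ / z‖) := by
    rw [Real.exp_neg, Real.exp_log (norm_pos_iff.2 (div_ne_zero hξ hz)), norm_div, inv_div]
  refine ⟨hz, hξ, ?_, ?_, ?_⟩
  · rw [hnorm]; exact Real.exp_le_exp.2 (by linarith)
  · rw [hnorm]; exact Real.exp_le_exp.2 (by linarith)
  · rwa [Complex.angle_eq_abs_arg hξ hz]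

theorem isMultApprox_prod {ι : Type*} [Fintype ι] {ε δ : ℝ} {z ξ : ι → ℂ} (hz : ∀ i, z i ≠ 0)
    (h : ∀ i, ‖ξ i / z i - 1‖ ≤ δ) (hδ : Fintype.card ι * δ ≤ min ε 1 / 8) :
    IsMultApprox ε (∏ i, z i) (∏ i, ξ i) := by
  refine isMultApprox_of_norm_le (Finset.prod_ne_zero_iff.2 fun i _ => hz i) ?_
  set S := ∑ i, ‖ξ i / z i - 1‖
  have hS0 : 0 ≤ S := Finset.sum_nonneg fun _ _ => norm_nonneg _
  have hS : S ≤ min ε 1 / 8 := by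
    refine (Finset.sum_le_sum fun i _ => h i).trans ?_
    rwa [Finset.sum_const, Finset.card_univ, nsmul_eq_mul]
  have hexp := Real.abs_exp_sub_one_le (x := S) (by
    rw [abs_of_nonneg hS0]; linarith [min_le_right ε 1])
  rw [abs_of_nonneg hS0] at hexp
  calc ‖(∏ i, ξ i) / ∏ i, z i - 1‖ = ‖∏ i, (1 + (ξ i / z i - 1)) - 1‖ := by
        simp only [add_sub_cancel, Finset.prod_div_distrib]
    _ ≤ Real.exp S - 1 := Finset.norm_prod_one_add_sub_one_le _ _
    _ ≤ min ε 1 / 4 := by linarith [le_abs_self (Real.exp S - 1)]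

namespace EdgeFamily

variable {m n : ℕ}

theorem norm_approxRatio_div_ratio_sub_one_le {V : Type*} [DecidableEq V] [Finite V] {q w : ℂ}
    {Δ : ℕ} (hq : IsContracting q w Δ) (k : ℕ) (N : Node m V)
    (hN : ∀ v, liveDegree N.edges v ≤ Δ) :
    ‖N.approxRatio q w k / ratio q w N.edges N.vertex - 1‖ ≤ 2 * 4 ^ Δ / 2 ^ k := by
  have hN' : DegreeLEAwayFrom Δ N.edges N.vertex := fun v _ => hN v
  have hhalf := half_le_norm_ratio (ratioNearOne hq _ _ hN') (hN _)
  have hpos : 0 < ‖ratio q w N.edges N.vertex‖ := by linarith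
  rw [div_sub_one (norm_pos_iff.1 hpos), norm_div, div_le_iff₀ hpos]
  calc _ ≤ 4 ^ liveDegree N.edges N.vertex / 2 ^ k := N.norm_approxRatio_sub_ratio_le hq k hN'
    _ ≤ 4 ^ Δ / 2 ^ k := by gcongr; exacts [by norm_num, hN _]
    _ = 2 * 4 ^ Δ / 2 ^ k * (1 / 2) := by ring
    _ ≤ _ := by gcongr

/-- The product of the approximate ratios of the vertices, where vertex `i` is treated after the
vertices below it have been removed. -/
noncomputable def approxClusterSum (q w : ℂ) (k : ℕ) (E : Fin m → Fin n × Fin n) : ℂ :=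
  ∏ i : Fin n, q * Node.approxRatio q w k ⟨dropBelow i E, i⟩

theorem isMultApprox_approxClusterSum {q w : ℂ} {Δ k : ℕ} {ε : ℝ} (hq : IsContracting q w Δ)
    {E : Fin m → Fin n × Fin n} (hE : ∀ v, liveDegree E v ≤ Δ)
    (hk : 16 * 4 ^ Δ * n ≤ 2 ^ k * min ε 1) :
    IsMultApprox ε (clusterSum q w E) (approxClusterSum q w k E) := by
  have hdeg (i : ℕ) (v : Fin n) : liveDegree (dropBelow i E) v ≤ Δ :=
    (liveDegree_dropBelow_le i E v).trans (hE v)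
  have hnear (i : Fin n) := ratioNearOne hq (dropBelow i E) i fun v _ => hdeg i v
  rw [clusterSum_eq_prod_ratio E fun i => (hnear i).clusterSum_remove_ne_zero]
  refine isMultApprox_prod (δ := 2 * 4 ^ Δ / 2 ^ k) (fun i => mul_ne_zero hq.ne_zero ?_)
    (fun i => ?_) ?_
  · rw [← norm_pos_iff]
    linarith [half_le_norm_ratio (hnear i) (hdeg i i)]
  · rw [mul_div_mul_left _ _ hq.ne_zero]
    exact norm_approxRatio_div_ratio_sub_one_le hq k ⟨dropBelow i E, i⟩ (hdeg i)
  · rw [Fintype.card_fin, ← mul_div_assoc, div_le_div_iff₀ (by positivity) (by norm_num)]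
    linarith

end EdgeFamily

/-! ### Bounded runs of programs -/

theorem exists_polynomial_eval_le (P : Polynomial ℕ) :
    ∃ C, ∀ S, 1 ≤ S → P.eval S ≤ C * S ^ C := by
  refine ⟨P.eval 1 + P.natDegree, fun S hS => ?_⟩
  calc P.eval S = ∑ i ∈ Finset.range (P.natDegree + 1), P.coeff i * S ^ i := P.eval_eq_sum_range S
    _ ≤ ∑ i ∈ Finset.range (P.natDegree + 1), P.coeff i * S ^ P.natDegree :=
      Finset.sum_le_sum fun i hi => Nat.mul_le_mul_left _
        (Nat.pow_le_pow_right hS (Finset.mem_range_succ_iff.1 hi))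
    _ = P.eval 1 * S ^ P.natDegree := by simp [Polynomial.eval_eq_sum_range, Finset.sum_mul]
    _ ≤ (P.eval 1 + P.natDegree) * S ^ (P.eval 1 + P.natDegree) :=
      Nat.mul_le_mul (Nat.le_add_right _ _) (Nat.pow_le_pow_right hS (Nat.le_add_left _ _))

namespace ComplexRAM

/-- The entry `0` of the array `x`, used as a register. -/
abbrev reg (x : ℕ) : NatExp := .get x (.const 0)

namespace Program

/-- A bound for the running time of a program all of whose loops make at most `S` rounds. -/
def time (S : ℕ) : Program → ℕ
  | skip => 1
  | setNat _ i e => i.cost + e.cost + 1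
  | setNum _ i e => i.cost + e.cost + 1
  | seq p p' => p.time S + p'.time S
  | branch b p p' => b.cost + (p.time S + p'.time S)
  | loop b p => S * (b.cost + p.time S) + b.cost

theorem exists_polynomial_time_eq (p : Program) :
    ∃ P : Polynomial ℕ, ∀ S, p.time S = P.eval S := by
  induction p with
  | skip => exact ⟨.C 1, fun S => by simp [time]⟩
  | setNat _ i e => exact ⟨.C (i.cost + e.cost + 1), fun S => by simp [time]⟩
  | setNum _ i e => exact ⟨.C (i.cost + e.cost + 1), fun S => by simp [time]⟩
  | seq p p' ih ih' =>
    obtain ⟨P, hP⟩ := ih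
    obtain ⟨P', hP'⟩ := ih'
    exact ⟨P + P', fun S => by simp [time, hP, hP']⟩
  | branch b p p' ih ih' =>
    obtain ⟨P, hP⟩ := ih
    obtain ⟨P', hP'⟩ := ih'
    exact ⟨.C b.cost + (P + P'), fun S => by simp [time, hP, hP']⟩
  | loop b p ih =>
    obtain ⟨P, hP⟩ := ih
    exact ⟨.X * (.C b.cost + P) + .C b.cost, fun S => by simp [time, hP]⟩

/-- The arrays of natural numbers to which a program may write. -/
def natTargets : Program → List ℕ
  | skip => []
  | setNat x _ _ => [x]
  | setNum _ _ _ => []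
  | seq p p' => p.natTargets ++ p'.natTargets
  | branch _ p p' => p.natTargets ++ p'.natTargets
  | loop _ p => p.natTargets

/-- The arrays of complex numbers to which a program may write. -/
def numTargets : Program → List ℕ
  | skip => []
  | setNat _ _ _ => []
  | setNum x _ _ => [x]
  | seq p p' => p.numTargets ++ p'.numTargets
  | branch _ p p' => p.numTargets ++ p'.numTargets
  | loop _ p => p.numTargets

/-- The memory configurations `s` and `s'` agree outside the arrays to which `p` may write. -/
structure Frame (p : Program) (s s' : State) : Prop where
  nat_eq : ∀ x ∉ p.natTargets, s'.nat x = s.nat x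
  num_eq : ∀ x ∉ p.numTargets, s'.num x = s.num x

/-- Started in `s`, the program `p` halts in `s'` within the time that it needs if each of its loops
makes at most `S` rounds. -/
def Reaches (S : ℕ) (p : Program) (s s' : State) : Prop := ∃ t ≤ p.time S, Exec p s s' t

end Program

theorem Exec.frame {p : Program} {s s' : State} {t : ℕ} (h : Exec p s s' t) : p.Frame s s' := by
  induction h with
  | skip => exact ⟨fun _ _ => rfl, fun _ _ => rfl⟩
  | setNat => exact ⟨fun _ hx => Function.update_of_ne (List.ne_of_not_mem_cons hx) _ _,
      fun _ _ => rfl⟩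
  | setNum => exact ⟨fun _ _ => rfl,
      fun _ hx => Function.update_of_ne (List.ne_of_not_mem_cons hx) _ _⟩
  | seq _ _ ih ih' =>
    exact ⟨fun x hx => (ih'.nat_eq x fun h => hx (List.mem_append_right _ h)).trans
        (ih.nat_eq x fun h => hx (List.mem_append_left _ h)),
      fun x hx => (ih'.num_eq x fun h => hx (List.mem_append_right _ h)).trans
        (ih.num_eq x fun h => hx (List.mem_append_left _ h))⟩
  | branch_true _ _ ih =>
    exact ⟨fun x hx => ih.nat_eq x fun h => hx (List.mem_append_left _ h),
      fun x hx => ih.num_eq x fun h => hx (List.mem_append_left _ h)⟩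
  | branch_false _ _ ih =>
    exact ⟨fun x hx => ih.nat_eq x fun h => hx (List.mem_append_right _ h),
      fun x hx => ih.num_eq x fun h => hx (List.mem_append_right _ h)⟩
  | loop_true _ _ _ ih ih' =>
    exact ⟨fun x hx => (ih'.nat_eq x hx).trans (ih.nat_eq x hx),
      fun x hx => (ih'.num_eq x hx).trans (ih.num_eq x hx)⟩
  | loop_false => exact ⟨fun _ _ => rfl, fun _ _ => rfl⟩

namespace Program

variable {S : ℕ} {p p' : Program} {s s' s'' : State}

theorem Frame.mono (h : p.Frame s s') (hnat : p.natTargets ⊆ p'.natTargets)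
    (hnum : p.numTargets ⊆ p'.numTargets) : p'.Frame s s' :=
  ⟨fun x hx => h.nat_eq x fun hp => hx (hnat hp), fun x hx => h.num_eq x fun hp => hx (hnum hp)⟩

theorem Frame.trans (h : p.Frame s s') (h' : p.Frame s' s'') : p.Frame s s'' :=
  ⟨fun x hx => (h'.nat_eq x hx).trans (h.nat_eq x hx),
    fun x hx => (h'.num_eq x hx).trans (h.num_eq x hx)⟩

theorem Reaches.frame (h : p.Reaches S s s') : p.Frame s s' := h.choose_spec.2.frame

theorem Reaches.nat_eq (h : p.Reaches S s s') {x : ℕ} (hx : x ∉ p.natTargets := by decide) :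
    s'.nat x = s.nat x := h.frame.nat_eq x hx

theorem Reaches.num_eq (h : p.Reaches S s s') {x : ℕ} (hx : x ∉ p.numTargets := by decide) :
    s'.num x = s.num x := h.frame.num_eq x hx

theorem Reaches.seq (h : p.Reaches S s s') (h' : p'.Reaches S s' s'') :
    (Program.seq p p').Reaches S s s'' := by
  obtain ⟨t, ht, h⟩ := h
  obtain ⟨t', ht', h'⟩ := h'
  exact ⟨t + t', Nat.add_le_add ht ht', h.seq h'⟩

theorem exists_reaches_loop {b : Test} {N : ℕ} {I : ℕ → State → Prop} (hN : N ≤ S) (h0 : I 0 s)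
    (hstep : ∀ k < N, ∀ s, I k s → b.Holds s ∧ ∃ s', p.Reaches S s s' ∧ I (k + 1) s')
    (hlast : ∀ s, I N s → ¬ b.Holds s) : ∃ s', (Program.loop b p).Reaches S s s' ∧ I N s' := by
  suffices ∃ s', (∃ t ≤ N * (b.cost + p.time S) + b.cost, Exec (.loop b p) s s' t) ∧ I N s' by
    obtain ⟨s', ⟨t, ht, h⟩, hs'⟩ := this
    exact ⟨s', ⟨t, ht.trans (Nat.add_le_add_right (Nat.mul_le_mul_right _ hN) _), h⟩, hs'⟩
  clear hN
  induction N generalizing I s with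
  | zero => exact ⟨s, ⟨_, by omega, .loop_false (hlast s h0)⟩, h0⟩
  | succ N ih =>
    obtain ⟨hb, s₁, ⟨t₁, ht₁, h₁⟩, hs₁⟩ := hstep 0 N.succ_pos s h0
    obtain ⟨s₂, ⟨t₂, ht₂, h₂⟩, hs₂⟩ := ih (I := fun k => I (k + 1)) hs₁
      (fun k hk => hstep (k + 1) (Nat.succ_lt_succ hk)) hlast
    refine ⟨s₂, ⟨_, ?_, .loop_true hb h₁ h₂⟩, hs₂⟩
    rw [Nat.succ_mul]
    omega

/-- The program contains no loop. -/
def LoopFree : Program → Bool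
  | loop _ _ => false
  | seq p p' => p.LoopFree && p'.LoopFree
  | branch _ p p' => p.LoopFree && p'.LoopFree
  | _ => true

open Classical in
/-- The effect of a program without loops. -/
noncomputable def run : Program → State → State
  | setNat x i e, s => s.setNat x (i.eval s) (e.eval s)
  | setNum x i e, s => s.setNum x (i.eval s) (e.eval s)
  | seq p p', s => p'.run (p.run s)
  | branch b p p', s => if b.Holds s then p.run s else p'.run s
  | _, s => s

theorem reaches_run (S : ℕ) (s : State) (h : p.LoopFree := by decide) :
    p.Reaches S s (p.run s) := by
  induction p generalizing s with
  | skip => exact ⟨_, le_rfl, .skip s⟩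
  | setNat x i e => exact ⟨_, le_rfl, .setNat s x i e⟩
  | setNum x i e => exact ⟨_, le_rfl, .setNum s x i e⟩
  | seq p p' ih ih' =>
    rw [LoopFree, Bool.and_eq_true] at h
    exact (ih s h.1).seq (ih' _ h.2)
  | branch b p p' ih ih' =>
    rw [LoopFree, Bool.and_eq_true] at h
    rw [run]
    split_ifs with hb
    · obtain ⟨t, ht, he⟩ := ih s h.1
      exact ⟨_, by rw [time]; omega, .branch_true hb he⟩
    · obtain ⟨t, ht, he⟩ := ih' s h.2
      exact ⟨_, by rw [time]; omega, .branch_false hb he⟩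
  | loop => exact absurd h Bool.false_ne_true

/-- `for reg x = 0, …, reg y - 1 do p`. -/
def forLoop (x y : ℕ) (p : Program) : Program :=
  .seq (.setNat x (.const 0) (.const 0))
    (.loop (.natLe (.add (reg x) (.const 1)) (reg y))
      (.seq p (.setNat x (.const 0) (.add (reg x) (.const 1)))))

/-- `if a ≤ b then p else p'`. -/
def ifLe (a b : NatExp) (p p' : Program) : Program := .branch (.natLe a b) p p'

theorem run_ifLe (a b : NatExp) (p p' : Program) (s : State) :
    (ifLe a b p p').run s = if a.eval s ≤ b.eval s then p.run s else p'.run s := by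
  simp only [ifLe, run, Test.Holds]
  congr

/-- `if a = b then p else p'`. -/
def ifEq (a b : NatExp) (p p' : Program) : Program := ifLe a b (ifLe b a p p') p'

theorem run_ifEq (a b : NatExp) (p p' : Program) (s : State) :
    (ifEq a b p p').run s = if a.eval s = b.eval s then p.run s else p'.run s := by
  simp only [ifEq, run_ifLe]
  grind

theorem exists_reaches_forLoop {x y N : ℕ} {I : ℕ → State → Prop} (hy : s.nat y 0 = N)
    (hN : N ≤ S) (h0 : I 0 s)
    (hstep : ∀ k < N, ∀ s', (forLoop x y p).Frame s s' → s'.nat x 0 = k → I k s' →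
      ∃ s'', p.Reaches S s' s'' ∧ I (k + 1) s'')
    (hI : ∀ k s v, I k s → I k (s.setNat x 0 v) := by exact fun _ _ _ h => h)
    (hxp : x ∉ p.natTargets := by decide) (hyp : y ∉ (forLoop x y p).natTargets := by decide) :
    ∃ s', (forLoop x y p).Reaches S s s' ∧ I N s' := by
  have hreset : (Program.setNat x (.const 0) (.const 0)).Reaches S s (s.setNat x 0 0) :=
    ⟨_, le_rfl, .setNat ..⟩
  suffices h : ∃ s', _ ∧ I N s' ∧ s'.nat x 0 = N ∧ (forLoop x y p).Frame s s' by
    obtain ⟨s', hs', hI', -, -⟩ := h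
    exact ⟨s', hreset.seq hs', hI'⟩
  refine exists_reaches_loop
    (I := fun k s' => I k s' ∧ s'.nat x 0 = k ∧ (forLoop x y p).Frame s s') hN
    ⟨hI 0 s 0 h0, by simp [State.setNat],
      hreset.frame.mono (by simp [forLoop, natTargets]) (by simp [numTargets])⟩ ?_ ?_
  · rintro k hk s₁ ⟨hI₁, hx₁, hf₁⟩
    have hy₁ : s₁.nat y 0 = N := by rw [hf₁.nat_eq y hyp, hy]
    obtain ⟨s₂, hs₂, hI₂⟩ := hstep k hk s₁ hf₁ hx₁ hI₁
    have hincr : (Program.setNat x (.const 0) (.add (reg x) (.const 1))).Reaches S s₂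
        (s₂.setNat x 0 (s₂.nat x 0 + 1)) := ⟨_, le_rfl, .setNat ..⟩
    refine ⟨by simp only [Test.Holds, NatExp.eval]; omega, _, hs₂.seq hincr, hI _ _ _ hI₂, ?_, ?_⟩
    · simp [State.setNat, hs₂.nat_eq hxp, hx₁]
    · exact hf₁.trans ((hs₂.seq hincr).frame.mono (by simp [forLoop, natTargets])
        (by simp [forLoop, numTargets]))
  · rintro s₁ ⟨-, hx₁, hf₁⟩
    simp only [Test.Holds, NatExp.eval, hx₁, hf₁.nat_eq y hyp, hy]
    omega

end Program

end ComplexRAM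

/-! ### The algorithm -/

namespace ComplexRAM

open Program

local infixr:60 " ;; " => Program.seq

/-! The arrays of the algorithm. The arrays `n`, `m`, `fst`, `snd`, `q`, `w`, `eps` and `out` are
those prescribed for the input and the output. The arrays `fst` and `snd` contain a queue of blocks
of `m` edges: first the given edge list, then the edges of the nodes of the heap. -/

namespace Mem

abbrev n : ℕ := 0
abbrev m : ℕ := 1
abbrev fst : ℕ := 2
abbrev snd : ℕ := 3
abbrev vertex : ℕ := 4
abbrev base : ℕ := 5
abbrev free : ℕ := 6
abbrev i : ℕ := 7
abbrev h : ℕ := 8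
abbrev j : ℕ := 9
abbrev a : ℕ := 10
abbrev b : ℕ := 11
abbrev u : ℕ := 12
abbrev v : ℕ := 13
abbrev size : ℕ := 14

abbrev q : ℕ := 0
abbrev w : ℕ := 1
abbrev eps : ℕ := 2
abbrev out : ℕ := 3
abbrev weight : ℕ := 4
abbrev dev : ℕ := 5
abbrev gap : ℕ := 6

end Mem

/-- `reg x := e`. -/
def assign (x : ℕ) (e : NatExp) : Program := .setNat x (.const 0) e

/-- Run `p` for each edge of the block at `base`, with its ends in the registers `a` and `b`. -/
def forEdges (p : Program) : Program :=
  forLoop Mem.j Mem.m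
    (assign Mem.a (.get Mem.fst (.add (reg Mem.base) (reg Mem.j))) ;;
      assign Mem.b (.get Mem.snd (.add (reg Mem.base) (reg Mem.j))) ;; p)

/-- Append the edge in the registers `a` and `b` to the queue. -/
def pushEdge : Program :=
  .setNat Mem.fst (reg Mem.free) (reg Mem.a) ;; .setNat Mem.snd (reg Mem.free) (reg Mem.b) ;;
    assign Mem.free (.add (reg Mem.free) (.const 1))

/-- Append to the queue the edges of the block at `base`, each of them transformed by `p`. -/
def appendEdges (p : Program) : Program := forEdges (p ;; pushEdge)

/-- Delete the edge if one of its ends is below `i`. -/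
def dropEdge : Program :=
  ifLe (reg Mem.i) (reg Mem.a)
    (ifLe (reg Mem.i) (reg Mem.b) .skip (assign Mem.b (reg Mem.a)))
    (assign Mem.b (reg Mem.a))

/-- Delete the edge if it joins `u` and `v`. -/
def cutEdge : Program :=
  ifEq (reg Mem.a) (reg Mem.u)
      (ifEq (reg Mem.b) (reg Mem.v) (assign Mem.b (reg Mem.a)) .skip) .skip ;;
    ifEq (reg Mem.a) (reg Mem.v)
      (ifEq (reg Mem.b) (reg Mem.u) (assign Mem.b (reg Mem.a)) .skip) .skip

/-- Move the ends of the edge from `u` to `v`. -/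
def mergeEdge : Program :=
  ifEq (reg Mem.a) (reg Mem.u) (assign Mem.a (reg Mem.v)) .skip ;;
    ifEq (reg Mem.b) (reg Mem.u) (assign Mem.b (reg Mem.v)) .skip

/-- Delete the edge if `v` is one of its ends. -/
def removeEdge : Program :=
  ifEq (reg Mem.a) (reg Mem.v) (assign Mem.b (reg Mem.a))
    (ifEq (reg Mem.b) (reg Mem.v) (assign Mem.b (reg Mem.a)) .skip)

/-- Let `u` be the end of the edge other than `v`, if the edge is at `v`. -/
def updateNeighbour : Program :=
  ifEq (reg Mem.a) (reg Mem.v)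
    (ifEq (reg Mem.b) (reg Mem.v) .skip (assign Mem.u (reg Mem.b)))
    (ifEq (reg Mem.b) (reg Mem.v) (assign Mem.u (reg Mem.a)) .skip)

/-- Let `u` be a neighbour of `v`. -/
def findNeighbour : Program := assign Mem.u (reg Mem.v) ;; forEdges updateNeighbour

/-- Multiply the weight of the node `h` by `1 + w` if the edge joins `u` and `v`. -/
def updateWeight : Program :=
  ifEq (reg Mem.a) (reg Mem.b) .skip
    (cutEdge ;; ifEq (reg Mem.a) (reg Mem.b)
      (.setNum Mem.weight (reg Mem.h) (.mul (.get Mem.weight (reg Mem.h))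
        (.add (.ofNat (.const 1)) (.get Mem.w (.const 0))))) .skip)

/-- Compute the weight of the contracted term at the node `h`. -/
def computeWeight : Program :=
  .setNum Mem.weight (reg Mem.h) (.ofNat (.const 1)) ;; forEdges updateWeight ;;
    .setNum Mem.weight (reg Mem.h) (.div (.sub (.get Mem.weight (reg Mem.h)) (.ofNat (.const 1)))
      (.get Mem.q (.const 0)))

/-- The number of the child `r` of the node `h`. -/
def childIndex (r : ℕ) : NatExp :=
  .add (.add (.add (reg Mem.h) (reg Mem.h)) (reg Mem.h)) (.const (r + 1))

/-- Append the edges of the children of the node `h` to the queue. -/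
def appendChildren : Program :=
  appendEdges cutEdge ;; appendEdges mergeEdge ;; appendEdges removeEdge

/-- Store the distinguished vertices of the children of the node `h`. -/
def labelChildren : Program :=
  .setNat Mem.vertex (childIndex 0) (reg Mem.v) ;; .setNat Mem.vertex (childIndex 1) (reg Mem.v) ;;
    .setNat Mem.vertex (childIndex 2) (reg Mem.u)

/-- Compute the weight and the children of the node `h`, whose block is at `base`. -/
def expandNode : Program :=
  assign Mem.v (.get Mem.vertex (reg Mem.h)) ;; findNeighbour ;; computeWeight ;;
    appendChildren ;; labelChildren ;; assign Mem.base (.add (reg Mem.base) (reg Mem.m))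

/-- Store the root of the recursion tree for the vertex `i`, with the vertices below `i` removed. -/
def plantRoot : Program :=
  (.setNat Mem.vertex (.const 0) (reg Mem.i) ;; assign Mem.base (.const 0) ;;
    assign Mem.free (reg Mem.m)) ;; appendEdges dropEdge ;; assign Mem.base (reg Mem.m)

/-- Compute the value of the node `h` from those of its children. The array `dev` stores the
deviations of the values from `1`, so that the leaves, which have value `1`, need no
initialization. -/
def evaluateNode : Program :=
  .setNum Mem.dev (reg Mem.h)
    (.add (.get Mem.dev (childIndex 0)) (.div
      (.mul (.get Mem.weight (reg Mem.h)) (.add (.ofNat (.const 1)) (.get Mem.dev (childIndex 1))))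
      (.add (.ofNat (.const 1)) (.get Mem.dev (childIndex 2)))))

/-- Evaluate the nodes of the heap from the last one to the root. -/
def evaluate : Program :=
  forLoop Mem.j Mem.size
    (assign Mem.h (.sub (reg Mem.size) (.add (reg Mem.j) (.const 1))) ;; evaluateNode)

/-- Multiply the output by `q` times the approximate ratio at the vertex `i`. -/
def processVertex : Program :=
  plantRoot ;; forLoop Mem.h Mem.size expandNode ;; evaluate ;;
    .setNum Mem.out (.const 0) (.mul (.get Mem.out (.const 0)) (.mul (.get Mem.q (.const 0))
      (.add (.ofNat (.const 1)) (.get Mem.dev (.const 0)))))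

/-- Let `gap` be the minimum of `ε` and `1`, and `size` be `0`. -/
def initSize : Program :=
  .branch (.reLe (.get Mem.eps (.const 0)) (.ofNat (.const 1)))
      (.setNum Mem.gap (.const 0) (.get Mem.eps (.const 0)))
      (.setNum Mem.gap (.const 0) (.ofNat (.const 1))) ;;
    assign Mem.size (.const 0)

/-- Double `gap`, and add one level to `size`. -/
def growSize : Program :=
  .setNum Mem.gap (.const 0) (.add (.get Mem.gap (.const 0)) (.get Mem.gap (.const 0))) ;;
    assign Mem.size (.add (.add (.add (reg Mem.size) (reg Mem.size)) (reg Mem.size)) (.const 1))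

/-- Let `size` be the number of nodes above level `K`, where `K` is the least number such that
`2 ^ K * min ε 1` exceeds `c * n`. -/
def chooseSize (c : ℕ) : Program :=
  initSize ;;
    .loop (.reLe (.get Mem.gap (.const 0)) (.mul (.ofNat (.const c)) (.ofNat (reg Mem.n)))) growSize

/-- The approximation algorithm; the constant `c` controls the depth of the recursion. -/
def approxTutte (c : ℕ) : Program :=
  chooseSize c ;; .setNum Mem.out (.const 0) (.ofNat (.const 1)) ;;
    forLoop Mem.i Mem.n processVertex

end ComplexRAM

/-! ### Scanning and copying blocks of edges -/

namespace ComplexRAM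

open Program

@[simp, grind =]
theorem State.setNat_nat (s : State) (x i v y j : ℕ) :
    (s.setNat x i v).nat y j = if y = x ∧ j = i then v else s.nat y j := by
  simp only [State.setNat, Function.update_apply]
  grind

@[simp, grind =]
theorem State.setNum_num (s : State) (x i : ℕ) (v : ℂ) (y j : ℕ) :
    (s.setNum x i v).num y j = if y = x ∧ j = i then v else s.num y j := by
  simp only [State.setNum, Function.update_apply]
  grind

@[simp, grind =]
theorem State.setNum_nat (s : State) (x i : ℕ) (v : ℂ) : (s.setNum x i v).nat = s.nat := rfl

@[simp, grind =]
theorem State.setNat_num (s : State) (x i v : ℕ) : (s.setNat x i v).num = s.num := rfl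

/-- The edge in the registers `a` and `b`. -/
def State.edge (s : State) : ℕ × ℕ := (s.nat Mem.a 0, s.nat Mem.b 0)

/-- The edge at position `i` of the queue. -/
def State.edgeAt (s : State) (i : ℕ) : ℕ × ℕ := (s.nat Mem.fst i, s.nat Mem.snd i)

/-- The block of `m` edges that starts at position `i` of the queue. -/
def State.block (s : State) (m i : ℕ) : Fin m → ℕ × ℕ := fun j => s.edgeAt (i + j)

variable {S m : ℕ} {s : State}

theorem edge_run_dropEdge (s : State) :
    (dropEdge.run s).edge = if s.nat Mem.i 0 ≤ s.nat Mem.a 0 ∧ s.nat Mem.i 0 ≤ s.nat Mem.b 0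
      then s.edge else (s.nat Mem.a 0, s.nat Mem.a 0) := by
  simp only [dropEdge, State.edge, assign, run, run_ifLe, NatExp.eval]
  grind

theorem edge_run_cutEdge (s : State) : (cutEdge.run s).edge =
    EdgeFamily.cutEdge (s.nat Mem.u 0) (s.nat Mem.v 0) s.edge := by
  simp only [cutEdge, EdgeFamily.cutEdge, State.edge, assign, run, run_ifEq, NatExp.eval]
  grind

theorem edge_run_mergeEdge (s : State) : (mergeEdge.run s).edge =
    EdgeFamily.mergeEdge (s.nat Mem.u 0) (s.nat Mem.v 0) s.edge := by
  simp only [mergeEdge, EdgeFamily.mergeEdge, EdgeFamily.relabel, State.edge, assign, run, run_ifEq,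
    NatExp.eval]
  grind

theorem edge_run_removeEdge (s : State) : (removeEdge.run s).edge =
    EdgeFamily.removeEdge (s.nat Mem.v 0) s.edge := by
  simp only [removeEdge, EdgeFamily.removeEdge, State.edge, assign, run, run_ifEq, NatExp.eval]
  grind

theorem exists_reaches_forEdges {p : Program} {I : ℕ → State → Prop} (hm : s.nat Mem.m 0 = m)
    (hS : m ≤ S) (h0 : I 0 s)
    (hstep : ∀ k < m, ∀ s', (forEdges p).Frame s s' →
      s'.edge = s'.edgeAt (s.nat Mem.base 0 + k) → I k s' → I (k + 1) (p.run s'))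
    (hp : p.LoopFree := by decide)
    (hnat : ∀ x ∈ [Mem.base, Mem.m, Mem.j], x ∉ p.natTargets := by decide)
    (hj : ∀ k s v, I k s → I k (s.setNat Mem.j 0 v) := by exact fun _ _ _ h => h)
    (hab : ∀ k s v v', I k s → I k ((s.setNat Mem.a 0 v).setNat Mem.b 0 v') := by
      exact fun _ _ _ _ h => h) :
    ∃ s', (forEdges p).Reaches S s s' ∧ I m s' := by
  simp only [List.mem_cons, List.not_mem_nil, or_false, forall_eq_or_imp, forall_eq] at hnat
  refine exists_reaches_forLoop hm hS h0 (fun k hk s' hs' hks hI => ?_) hj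
    (by simp [natTargets, assign, hnat]) (by simp [forLoop, natTargets, assign, hnat])
  have hbase : s'.nat Mem.base = s.nat Mem.base :=
    hs'.nat_eq _ (by simp [forLoop, natTargets, assign, hnat])
  refine ⟨_, reaches_run S s' (by simpa [LoopFree, assign] using hp),
    hstep k hk ((s'.setNat Mem.a 0 _).setNat Mem.b 0 _) (hs'.trans ⟨?_, fun _ _ => rfl⟩) ?_
      (hab k s' _ _ hI)⟩
  · intro x hx
    simp only [forLoop, assign, natTargets, List.mem_append, List.mem_cons, not_or] at hx
    simp only [State.setNat, Function.update_of_ne hx.2.1.1.1, Function.update_of_ne hx.2.1.2.1.1]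
  · simp [State.edge, State.edgeAt, run, assign, NatExp.eval, hks, hbase]

theorem exists_reaches_forEdges_foldl {σ : Type*} {p : Program} {f : σ → ℕ × ℕ → σ} {x : σ}
    {R : State → σ → Prop} (hm : s.nat Mem.m 0 = m) (hS : m ≤ S) (h0 : R s x)
    (hstep : ∀ s' y, (forEdges p).Frame s s' → R s' y → R (p.run s') (f y s'.edge))
    (hp : p.LoopFree := by decide)
    (hnat : ∀ x ∈ [Mem.base, Mem.m, Mem.j, Mem.fst, Mem.snd], x ∉ p.natTargets := by decide)
    (hj : ∀ s y v, R s y → R (s.setNat Mem.j 0 v) y := by exact fun _ _ _ h => h)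
    (hab : ∀ s y v v', R s y → R ((s.setNat Mem.a 0 v).setNat Mem.b 0 v') y := by
      exact fun _ _ _ _ h => h) :
    ∃ s', (forEdges p).Reaches S s s' ∧
      R s' ((List.ofFn (s.block m (s.nat Mem.base 0))).foldl f x) := by
  set l := List.ofFn (s.block m (s.nat Mem.base 0)) with hl
  have hlen : l.length = m := List.length_ofFn
  have hlstep (k : ℕ) (hk : k < m) (s' : State) (hs' : (forEdges p).Frame s s')
      (he : s'.edge = s'.edgeAt (s.nat Mem.base 0 + k)) (hR : R s' ((l.take k).foldl f x)) :
      R (p.run s') ((l.take (k + 1)).foldl f x) := by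
    simp only [List.mem_cons, List.not_mem_nil, or_false, forall_eq_or_imp, forall_eq] at hnat
    have hfst : s'.nat Mem.fst = s.nat Mem.fst :=
      hs'.nat_eq _ (by simp [forEdges, forLoop, natTargets, assign, hnat])
    have hsnd : s'.nat Mem.snd = s.nat Mem.snd :=
      hs'.nat_eq _ (by simp [forEdges, forLoop, natTargets, assign, hnat])
    have hget : s'.edge = l[k] := by
      rw [he, State.edgeAt, hfst, hsnd]
      simp [hl, State.block, State.edgeAt]
    rw [List.take_add_one, List.getElem?_eq_getElem (by omega), Option.toList_some,
      List.foldl_append, List.foldl_cons, List.foldl_nil, ← hget]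
    exact hstep s' _ hs' hR
  obtain ⟨s', hs', hR⟩ := exists_reaches_forEdges (I := fun k s' => R s' ((l.take k).foldl f x))
    hm hS h0 hlstep hp (by grind) (fun k s => hj s _) (fun k s => hab s _)
  exact ⟨s', hs', by rwa [← hlen, List.take_length] at hR⟩

theorem exists_reaches_findNeighbour (hm : s.nat Mem.m 0 = m) (hS : m ≤ S) :
    ∃ s', findNeighbour.Reaches S s s' ∧ s'.nat Mem.u 0 =
      EdgeFamily.neighbour (s.block m (s.nat Mem.base 0)) (s.nat Mem.v 0) := by
  have hstep (s' : State) (u : ℕ) (hv : s'.nat Mem.v = s.nat Mem.v) (hu : s'.nat Mem.u 0 = u) :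
      (updateNeighbour.run s').nat Mem.u 0 = EdgeFamily.otherEnd (s.nat Mem.v 0) u s'.edge := by
    simp only [updateNeighbour, run_ifEq, run, assign, NatExp.eval, EdgeFamily.otherEnd, State.edge,
      hv]
    grind
  have hassign := reaches_run (p := assign Mem.u (reg Mem.v)) S s
  obtain ⟨s', hs', hu⟩ := exists_reaches_forEdges_foldl (s := (assign Mem.u (reg Mem.v)).run s)
    (R := fun s' u => s'.nat Mem.u 0 = u) hm hS rfl
    fun s' y hs' => hstep s' y (hs'.nat_eq Mem.v (by decide))
  exact ⟨s', hassign.seq hs', hu⟩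

theorem foldl_ite_mul {σ R : Type*} [CommMonoid R] (c x : R) (P : σ → Prop) [DecidablePred P]
    (E : Fin m → σ) : (List.ofFn E).foldl (fun y e => if P e then y * c else y) x =
      x * c ^ (Finset.univ.filter fun i => P (E i)).card := by
  have hfoldl (l : List σ) : l.foldl (fun y e => if P e then y * c else y) x =
      x * (l.map fun e => if P e then c else 1).prod := by
    induction l generalizing x with
    | nil => simp
    | cons e l ih => rw [List.foldl_cons, ih]; split_ifs <;> simp [*, mul_assoc]
  rw [hfoldl, List.map_ofFn, List.prod_ofFn]
  simp [Finset.prod_ite]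

theorem num_weight_run_updateWeight (s : State) :
    (updateWeight.run s).num Mem.weight =
      if s.edge.1 ≠ s.edge.2 ∧ (s.edge = (s.nat Mem.u 0, s.nat Mem.v 0) ∨
          s.edge = (s.nat Mem.v 0, s.nat Mem.u 0)) then
        Function.update (s.num Mem.weight) (s.nat Mem.h 0)
          (s.num Mem.weight (s.nat Mem.h 0) * (1 + s.num Mem.w 0))
      else s.num Mem.weight := by
  simp only [updateWeight, cutEdge, assign, run_ifEq, NatExp.eval, run, NumExp.eval, Nat.cast_one,
    State.edge, ne_eq, Prod.mk.injEq]
  grind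

theorem exists_reaches_computeWeight {q w : ℂ} {h : ℕ} (hm : s.nat Mem.m 0 = m) (hS : m ≤ S)
    (hq : s.num Mem.q 0 = q) (hw : s.num Mem.w 0 = w) (hh : s.nat Mem.h 0 = h) :
    ∃ s', computeWeight.Reaches S s s' ∧
      s'.num Mem.weight = Function.update (s.num Mem.weight) h (EdgeFamily.contractWeight q w
        (s.nat Mem.u 0) (s.nat Mem.v 0) (s.block m (s.nat Mem.base 0))) := by
  subst hq hw hh
  have hinit : (Program.setNum Mem.weight (reg Mem.h) (.ofNat (.const 1))).Reaches S s
      (s.setNum Mem.weight (s.nat Mem.h 0) 1) := by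
    simpa [run, NatExp.eval, NumExp.eval] using
      reaches_run (p := .setNum Mem.weight (reg Mem.h) (.ofNat (.const 1))) S s
  obtain ⟨s', hs', hweight⟩ := exists_reaches_forEdges_foldl (p := updateWeight)
    (s := s.setNum Mem.weight (s.nat Mem.h 0) 1)
    (R := fun s' y => s'.num Mem.weight = Function.update (s.num Mem.weight) (s.nat Mem.h 0) y)
    (f := fun y e => if e.1 ≠ e.2 ∧
      (e = (s.nat Mem.u 0, s.nat Mem.v 0) ∨ e = (s.nat Mem.v 0, s.nat Mem.u 0))
        then y * (1 + s.num Mem.w 0) else y) (x := 1) hm hS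
    (by simp [State.setNum])
    fun s' y hs' hy => by
      have hu : s'.nat Mem.u = s.nat Mem.u := hs'.nat_eq Mem.u (by decide)
      have hv : s'.nat Mem.v = s.nat Mem.v := hs'.nat_eq Mem.v (by decide)
      have hh : s'.nat Mem.h = s.nat Mem.h := hs'.nat_eq Mem.h (by decide)
      have hw : s'.num Mem.w = s.num Mem.w := hs'.num_eq Mem.w (by decide)
      simp only [num_weight_run_updateWeight, hu, hv, hh, hw, hy, Function.update_self,
        Function.update_idem]
      split_ifs <;> rfl
  rw [foldl_ite_mul] at hweight
  have hh : s'.nat Mem.h = s.nat Mem.h := hs'.nat_eq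
  have hq : s'.num Mem.q = s.num Mem.q := hs'.num_eq
  refine ⟨_, hinit.seq (hs'.seq (reaches_run S s')), ?_⟩
  simp only [run, State.setNum, hweight, ne_eq, one_mul, NatExp.eval, hh, NumExp.eval,
    Function.update_self, Nat.cast_one, hq, Function.update_idem, EdgeFamily.contractWeight,
    EdgeFamily.between, EdgeFamily.live, Finset.filter_filter]
  rfl

end ComplexRAM

/-! ### Growing the recursion tree -/

namespace ComplexRAM

open Program
open EdgeFamily (Node)

/-- The queue consists of the `c` blocks `B 0, …, B (c - 1)` of `m` edges. -/
def State.Queue (s : State) (m c : ℕ) (B : ℕ → Fin m → ℕ × ℕ) : Prop :=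
  s.nat Mem.free 0 = c * m ∧ ∀ i < c, s.block m (i * m) = B i

variable {S m b c : ℕ} {s : State} {B : ℕ → Fin m → ℕ × ℕ}

theorem edgeAt_run_pushEdge (s : State) (i : ℕ) :
    (pushEdge.run s).edgeAt i = if i = s.nat Mem.free 0 then s.edge else s.edgeAt i := by
  simp only [pushEdge, assign, State.edgeAt, State.edge, run, NatExp.eval]
  grind

theorem exists_reaches_appendEdges {p : Program} {g : ℕ × ℕ → ℕ × ℕ} (hm : s.nat Mem.m 0 = m)
    (hS : m ≤ S) (hB : s.Queue m c B) (hbase : s.nat Mem.base 0 = b * m) (hb : b < c)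
    (hBc : B c = g ∘ B b)
    (hstep : ∀ s', (appendEdges p).Frame s s' → (p.run s').edge = g s'.edge)
    (hp : p.LoopFree := by decide) (hnat : ∀ x ∈ p.natTargets, x = Mem.a ∨ x = Mem.b := by decide) :
    ∃ s', (appendEdges p).Reaches S s s' ∧ s'.Queue m (c + 1) B := by
  have hframe {x : ℕ} (hx : x ≠ Mem.a ∧ x ≠ Mem.b) (s' : State) : (p.run s').nat x = s'.nat x :=
    (reaches_run S s' hp).nat_eq fun h => by grind [hnat x h]
  obtain ⟨s', hs', hfree, hblock, hlast⟩ := exists_reaches_forEdges (s := s) (p := p.seq pushEdge)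
    (I := fun k s' => s'.nat Mem.free 0 = c * m + k ∧ (∀ i < c, s'.block m (i * m) = B i) ∧
      ∀ j : Fin m, j < k → s'.edgeAt (c * m + j) = B c j) hm hS ⟨hB.1, hB.2, by simp⟩
    (fun k hk s' hs' hedge ⟨hfree, hblock, hlast⟩ => by
      have hpush (i : ℕ) : ((p.seq pushEdge).run s').edgeAt i =
          if i = c * m + k then B c ⟨k, hk⟩ else s'.edgeAt i := by
        rw [run, edgeAt_run_pushEdge, hframe (by decide), hfree, hstep s' hs', hedge, hbase, hBc,
          Function.comp_apply, ← hblock b hb]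
        simp only [State.edgeAt, State.block,
          hframe (by decide : Mem.fst ≠ Mem.a ∧ Mem.fst ≠ Mem.b),
          hframe (by decide : Mem.snd ≠ Mem.a ∧ Mem.snd ≠ Mem.b)]
      refine ⟨?_, fun i hi => funext fun j => ?_, fun j hj => ?_⟩
      · simp [run, pushEdge, assign, NatExp.eval, hframe, hfree, add_assoc]
      · have hij : i * m + j < c * m + k := by
          have := Nat.mul_le_mul_right m (Nat.succ_le_of_lt hi)
          rw [Nat.succ_mul] at this
          omega
        rw [State.block, hpush, if_neg hij.ne, ← hblock i hi, State.block]
      · rw [hpush]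
        split_ifs with h
        · exact congrArg (B c) (Fin.ext (Nat.add_left_cancel h.symm))
        · exact hlast j (by omega))
    (by simpa [LoopFree] using ⟨hp, by decide⟩) (by simp [natTargets, pushEdge, assign]; grind)
  refine ⟨s', hs', by rw [hfree, Nat.succ_mul], fun i hi => ?_⟩
  obtain hi | rfl := Nat.lt_succ_iff_lt_or_eq.1 hi
  · exact hblock i hi
  · exact funext fun j => hlast j j.2

/-- The blocks of the queue: the edge list `E`, then the edges of the nodes of the heap. -/
def blocks (E : Fin m → ℕ × ℕ) (root : Node m ℕ) : ℕ → Fin m → ℕ × ℕ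
  | 0 => E
  | i + 1 => (root.heap i).edges

theorem blocks_child (E : Fin m → ℕ × ℕ) (root : Node m ℕ) (k : ℕ) {r : ℕ} (hr : r < 3) :
    blocks E root (3 * k + r + 2) = ((root.heap k).child r).edges := by
  rw [blocks, Node.heap_child root k hr]

/-- The nodes `0, …, 3 * k` of the heap are stored, and the weights of the first `k` of them. -/
structure State.Grown (s : State) (q w : ℂ) (E : Fin m → ℕ × ℕ) (root : Node m ℕ) (k : ℕ) :
    Prop where
  queue : s.Queue m (3 * k + 2) (blocks E root)
  base_eq : s.nat Mem.base 0 = (k + 1) * m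
  vertex_eq : ∀ i ≤ 3 * k, s.nat Mem.vertex i = (root.heap i).vertex
  weight_eq : ∀ i < k, s.num Mem.weight i = (root.heap i).weight q w

theorem Program.Reaches.block_eq {p : Program} {s s' : State} (h : p.Reaches S s s') (m i : ℕ)
    (hp : ∀ x ∈ [Mem.fst, Mem.snd], x ∉ p.natTargets := by decide) :
    s'.block m i = s.block m i := by
  simp only [List.forall_mem_cons] at hp
  unfold State.block State.edgeAt
  rw [h.nat_eq hp.1, h.nat_eq hp.2.1]

theorem Program.Reaches.queue {p : Program} {s s' : State} (h : p.Reaches S s s')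
    (hB : s.Queue m c B) (hp : ∀ x ∈ [Mem.free, Mem.fst, Mem.snd], x ∉ p.natTargets := by decide) :
    s'.Queue m c B := by
  rw [List.forall_mem_cons] at hp
  exact ⟨by rw [h.nat_eq hp.1, hB.1], fun i hi => by rw [h.block_eq m _ hp.2, hB.2 i hi]⟩

variable {q w : ℂ} {E : Fin m → ℕ × ℕ} {root : Node m ℕ} {k : ℕ}

theorem exists_reaches_appendChildren (hm : s.nat Mem.m 0 = m) (hS : m ≤ S)
    (hB : s.Queue m (3 * k + 2) (blocks E root)) (hbase : s.nat Mem.base 0 = (k + 1) * m)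
    (hu : s.nat Mem.u 0 = (root.heap k).neighbour) (hv : s.nat Mem.v 0 = (root.heap k).vertex) :
    ∃ s', appendChildren.Reaches S s s' ∧ s'.Queue m (3 * (k + 1) + 2) (blocks E root) := by
  obtain ⟨s₁, hs₁, hB₁⟩ := exists_reaches_appendEdges (p := cutEdge)
    (g := EdgeFamily.cutEdge (root.heap k).neighbour (root.heap k).vertex) hm hS hB hbase
    (by omega) (blocks_child E root k (r := 0) (by norm_num)) fun s' hs' => by
      simpa only [hs'.nat_eq Mem.u (by decide), hs'.nat_eq Mem.v (by decide), hu, hv] using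
        edge_run_cutEdge s'
  rw [← hs₁.nat_eq] at hm hbase hu hv
  obtain ⟨s₂, hs₂, hB₂⟩ := exists_reaches_appendEdges (p := mergeEdge)
    (g := EdgeFamily.mergeEdge (root.heap k).neighbour (root.heap k).vertex) hm hS hB₁ hbase
    (by omega) (blocks_child E root k (r := 1) (by norm_num)) fun s' hs' => by
      simpa only [hs'.nat_eq Mem.u (by decide), hs'.nat_eq Mem.v (by decide), hu, hv] using
        edge_run_mergeEdge s'
  rw [← hs₂.nat_eq] at hm hbase hv
  obtain ⟨s₃, hs₃, hB₃⟩ := exists_reaches_appendEdges (p := removeEdge)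
    (g := EdgeFamily.removeEdge (root.heap k).vertex) hm hS hB₂ hbase
    (by omega) (blocks_child E root k (r := 2) (by norm_num)) fun s' hs' => by
      simpa only [hs'.nat_eq Mem.v (by decide), hv] using edge_run_removeEdge s'
  exact ⟨s₃, hs₁.seq (hs₂.seq hs₃), hB₃⟩

theorem nat_vertex_run_labelChildren (hs : ∀ i ≤ 3 * k, s.nat Mem.vertex i = (root.heap i).vertex)
    (hh : s.nat Mem.h 0 = k) (hu : s.nat Mem.u 0 = (root.heap k).neighbour)
    (hv : s.nat Mem.v 0 = (root.heap k).vertex) :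
    ∀ i ≤ 3 * (k + 1), (labelChildren.run s).nat Mem.vertex i = (root.heap i).vertex := by
  have hchild (r : ℕ) (hr : r < 3) : (root.heap (3 * k + r + 1)).vertex =
      ((root.heap k).child r).vertex := by rw [Node.heap_child root k hr]
  intro i hi
  simp only [labelChildren, childIndex, run, NatExp.eval, State.setNat_nat]
  have h0 := hchild 0 (by norm_num)
  have h1 := hchild 1 (by norm_num)
  have h2 := hchild 2 (by norm_num)
  simp only [Node.child] at h0 h1 h2
  grind

theorem exists_reaches_expandNode (hm : s.nat Mem.m 0 = m) (hS : m ≤ S)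
    (hq : s.num Mem.q 0 = q) (hw : s.num Mem.w 0 = w) (hh : s.nat Mem.h 0 = k)
    (hs : s.Grown q w E root k) :
    ∃ s', expandNode.Reaches S s s' ∧ s'.Grown q w E root (k + 1) := by
  have hload := reaches_run (p := assign Mem.v (.get Mem.vertex (reg Mem.h))) S s
  obtain ⟨s₁, hs₁, hu⟩ := exists_reaches_findNeighbour
    (s := (assign Mem.v (.get Mem.vertex (reg Mem.h))).run s) hm hS
  have h₁ := hload.seq hs₁
  have hblock : s₁.block m (s₁.nat Mem.base 0) = (root.heap k).edges := by
    rw [h₁.nat_eq, hs.base_eq, h₁.block_eq]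
    exact hs.queue.2 (k + 1) (by omega)
  have hv : s₁.nat Mem.v 0 = (root.heap k).vertex := by
    rw [hs₁.nat_eq, ← hs.vertex_eq k (by omega), ← hh]
    rfl
  rw [← hs₁.block_eq, ← hs₁.nat_eq (x := Mem.base), hblock, ← hs₁.nat_eq (x := Mem.v), hv] at hu
  obtain ⟨s₂, hs₂, hweight⟩ := exists_reaches_computeWeight (s := s₁) (q := q) (w := w) (h := k)
    (by rwa [h₁.nat_eq]) hS (by rwa [h₁.num_eq]) (by rwa [h₁.num_eq]) (by rwa [h₁.nat_eq])
  have h₂ := h₁.seq hs₂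
  obtain ⟨s₃, hs₃, hB⟩ := exists_reaches_appendChildren (s := s₂) (by rwa [h₂.nat_eq]) hS
    (h₂.queue hs.queue) (by rw [h₂.nat_eq, hs.base_eq]) (by rwa [hs₂.nat_eq]) (by rwa [hs₂.nat_eq])
  have h₃ := h₂.seq hs₃
  have hfinish := reaches_run
    (p := labelChildren.seq (assign Mem.base (.add (reg Mem.base) (reg Mem.m)))) S s₃
  refine ⟨_, hload.seq (hs₁.seq (hs₂.seq (hs₃.seq hfinish))), hfinish.queue hB, ?_, ?_, ?_⟩
  · change s₃.nat Mem.base 0 + s₃.nat Mem.m 0 = (k + 1 + 1) * m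
    rw [h₃.nat_eq, h₃.nat_eq, hs.base_eq, hm, ← Nat.succ_mul]
  · exact nat_vertex_run_labelChildren (s := s₃)
      (by simpa only [h₃.nat_eq (x := Mem.vertex)] using hs.vertex_eq)
      (by rwa [h₃.nat_eq]) (by rwa [(hs₂.seq hs₃).nat_eq]) (by rwa [(hs₂.seq hs₃).nat_eq])
  · intro i hi
    rw [hfinish.num_eq, hs₃.num_eq, hweight, hu, hv, hblock, Function.update_apply]
    split_ifs with hik
    · rw [hik]; rfl
    · rw [h₁.num_eq]
      exact hs.weight_eq i (by omega)

end ComplexRAM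

namespace ComplexRAM

open Program
open EdgeFamily (Node)

variable {S m : ℕ} {s : State} {q w : ℂ} {E : Fin m → ℕ × ℕ} {M : ℕ}

/-- The root of the recursion tree for the vertex `i`, with the vertices below `i` isolated. -/
def rootAt (E : Fin m → ℕ × ℕ) (i : ℕ) : Node m ℕ where
  edges j := if i ≤ (E j).1 ∧ i ≤ (E j).2 then E j else ((E j).1, (E j).1)
  vertex := i

theorem exists_reaches_plantRoot (hm : s.nat Mem.m 0 = m) (hS : m ≤ S) (hE : s.block m 0 = E) :
    ∃ s', plantRoot.Reaches S s s' ∧ s'.Grown q w E (rootAt E (s.nat Mem.i 0)) 0 := by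
  have hinit := reaches_run (p := (Program.setNat Mem.vertex (.const 0) (reg Mem.i)).seq
    ((assign Mem.base (.const 0)).seq (assign Mem.free (reg Mem.m)))) S s
  set s₀ := ((Program.setNat Mem.vertex (.const 0) (reg Mem.i)).seq
    ((assign Mem.base (.const 0)).seq (assign Mem.free (reg Mem.m)))).run s
  have hroot : (rootAt E (s.nat Mem.i 0)).heap 0 = rootAt E (s.nat Mem.i 0) := by rw [Node.heap]
  have hB : s₀.Queue m 1 (blocks E (rootAt E (s.nat Mem.i 0))) := by
    refine ⟨hm.trans (one_mul m).symm, fun i hi => ?_⟩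
    rw [Nat.lt_one_iff.1 hi, Nat.zero_mul, hinit.block_eq, hE]
    rfl
  obtain ⟨s₁, hs₁, hB₁⟩ := exists_reaches_appendEdges (s := s₀) (p := dropEdge) (b := 0)
    (g := fun e => if s.nat Mem.i 0 ≤ e.1 ∧ s.nat Mem.i 0 ≤ e.2 then e else (e.1, e.1))
    (by rwa [hinit.nat_eq]) hS hB (Nat.zero_mul m).symm one_pos
    (congrArg Node.edges hroot) fun s' hs' => by
      rw [edge_run_dropEdge, hs'.nat_eq Mem.i (by decide), hinit.nat_eq]
      rfl
  have hbase := reaches_run (p := assign Mem.base (reg Mem.m)) S s₁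
  refine ⟨_, hinit.seq (hs₁.seq hbase), hbase.queue hB₁, ?_, fun i hi => ?_, by simp⟩
  · change s₁.nat Mem.m 0 = (0 + 1) * m
    rw [hs₁.nat_eq, hinit.nat_eq, hm, zero_add, one_mul]
  · rw [Nat.le_zero.1 hi, Node.heap, hbase.nat_eq, hs₁.nat_eq]
    rfl

theorem exists_reaches_growTree {root : Node m ℕ} (hm : s.nat Mem.m 0 = m) (hS : m ≤ S)
    (hq : s.num Mem.q 0 = q) (hw : s.num Mem.w 0 = w) (hM : s.nat Mem.size 0 = M) (hMS : M ≤ S)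
    (hs : s.Grown q w E root 0) :
    ∃ s', (forLoop Mem.h Mem.size expandNode).Reaches S s s' ∧ s'.Grown q w E root M :=
  exists_reaches_forLoop (I := fun k s' => s'.Grown q w E root k) hM hMS hs
    (fun k _ s' hs' hk hI => exists_reaches_expandNode (by rwa [hs'.nat_eq _ (by decide)]) hS
      (by rwa [hs'.num_eq _ (by decide)]) (by rwa [hs'.num_eq _ (by decide)]) hk hI)
    fun _ _ _ h => ⟨h.1, h.2, h.3, h.4⟩

theorem num_dev_run_evaluateNode {root : Node m ℕ} {h : ℕ} (hh : s.nat Mem.h 0 = h) (hM : h < M)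
    (hweight : s.num Mem.weight h = (root.heap h).weight q w)
    (hdev : ∀ i > h, s.num Mem.dev i = root.heapValue q w M i - 1) :
    ∀ i ≥ h, (evaluateNode.run s).num Mem.dev i = root.heapValue q w M i - 1 := by
  intro i hi
  have hchild (r : ℕ) : s.num Mem.dev (h + h + h + (r + 1)) =
      root.heapValue q w M (3 * h + (r + 1)) - 1 := by
    rw [hdev _ (by omega)]
    congr 2
    ring
  obtain rfl | hi := hi.eq_or_lt
  · rw [Node.heapValue, if_pos hM]
    simp only [evaluateNode, childIndex, zero_add, Nat.reduceAdd, run, NatExp.eval, NumExp.eval,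
      State.setNum_num, and_self, ↓reduceIte, hh, hweight, hchild, Nat.cast_one, add_sub_cancel]
    ring
  · simp [evaluateNode, run, NatExp.eval, hh, hi.ne', hdev i hi]

theorem exists_reaches_evaluate {root : Node m ℕ} (hM : s.nat Mem.size 0 = M) (hMS : M ≤ S)
    (hweight : ∀ i < M, s.num Mem.weight i = (root.heap i).weight q w)
    (hdev : ∀ i ≥ M, s.num Mem.dev i = 0) :
    ∃ s', evaluate.Reaches S s s' ∧ ∀ i, s'.num Mem.dev i = root.heapValue q w M i - 1 := by
  obtain ⟨s', hs', hI⟩ := exists_reaches_forLoop (x := Mem.j)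
    (p := (assign Mem.h (.sub (reg Mem.size) (.add (reg Mem.j) (.const 1)))).seq evaluateNode)
    (I := fun k s' => ∀ i ≥ M - k, s'.num Mem.dev i = root.heapValue q w M i - 1) hM hMS
    (fun i hi => by rw [hdev i hi, Node.heapValue, if_neg (by omega), sub_self])
    fun k hk s' hs' hj hI => by
      refine ⟨_, reaches_run S s', ?_⟩
      have hsize : s'.nat Mem.size 0 = M := by rwa [hs'.nat_eq _ (by decide)]
      have hh : M - (s'.nat Mem.j 0 + 1) = M - (k + 1) := by rw [hj]
      refine num_dev_run_evaluateNode (s := (assign Mem.h _).run s') ?_ (by omega) ?_ ?_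
      · simp [assign, run, NatExp.eval, hsize, hh]
      · exact (congrFun (hs'.num_eq Mem.weight (by decide)) _).trans (hweight _ (by omega))
      · exact fun i hi => hI i (by omega)
  exact ⟨s', hs', fun i => hI i (by omega)⟩

theorem exists_reaches_processVertex (hm : s.nat Mem.m 0 = m) (hS : m ≤ S)
    (hq : s.num Mem.q 0 = q) (hw : s.num Mem.w 0 = w) (hM : s.nat Mem.size 0 = M) (hMS : M ≤ S)
    (hE : s.block m 0 = E) (hdev : ∀ i ≥ M, s.num Mem.dev i = 0) :
    ∃ s', processVertex.Reaches S s s' ∧ s'.block m 0 = E ∧ (∀ i ≥ M, s'.num Mem.dev i = 0) ∧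
      s'.num Mem.out 0 =
        s.num Mem.out 0 * (q * (rootAt E (s.nat Mem.i 0)).heapValue q w M 0) := by
  obtain ⟨s₁, hs₁, hroot⟩ := exists_reaches_plantRoot (q := q) (w := w) hm hS hE
  obtain ⟨s₂, hs₂, htree⟩ := exists_reaches_growTree (by rwa [hs₁.nat_eq]) hS
    (by rwa [hs₁.num_eq]) (by rwa [hs₁.num_eq]) (by rwa [hs₁.nat_eq]) hMS hroot
  have h₂ := hs₁.seq hs₂
  obtain ⟨s₃, hs₃, hvalue⟩ := exists_reaches_evaluate (by rwa [h₂.nat_eq]) hMS htree.weight_eq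
    (by rwa [h₂.num_eq])
  have h₃ := h₂.seq hs₃
  have hout := reaches_run (p := .setNum Mem.out (.const 0) (.mul (.get Mem.out (.const 0))
    (.mul (.get Mem.q (.const 0)) (.add (.ofNat (.const 1)) (.get Mem.dev (.const 0)))))) S s₃
  refine ⟨_, hs₁.seq (hs₂.seq (hs₃.seq hout)), ?_, fun i hi => ?_, ?_⟩
  · rw [hout.block_eq, hs₃.block_eq]
    simpa [blocks] using htree.queue.2 0 (by omega)
  · rw [hout.num_eq, hvalue, Node.heapValue, if_neg (by omega), sub_self]
  · simp [run, NatExp.eval, NumExp.eval, hvalue, h₃.num_eq (x := Mem.out),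
      h₃.num_eq (x := Mem.q), hq]

end ComplexRAM

/-! ### Relabelling the vertices -/

namespace EdgeFamily

variable {m : ℕ} {V W : Type*} [DecidableEq V] [DecidableEq W] {f : V → W}

theorem cut_map (hf : f.Injective) (u v : V) (E : Fin m → V × V) :
    cut (f u) (f v) (Prod.map f f ∘ E) = Prod.map f f ∘ cut u v E := by
  funext i
  simp only [cut, cutEdge, Function.comp_apply, Prod.ext_iff, Prod.map_fst, Prod.map_snd, hf.eq_iff,
    apply_ite (Prod.map f f), Prod.map_apply]

theorem merge_map (hf : f.Injective) (u v : V) (E : Fin m → V × V) :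
    merge (f u) (f v) (Prod.map f f ∘ E) = Prod.map f f ∘ merge u v E := by
  funext i
  simp only [merge, mergeEdge, relabel, Function.comp_apply, Prod.map_fst, Prod.map_snd, hf.eq_iff,
    apply_ite f, Prod.map_apply]

theorem remove_map (hf : f.Injective) (v : V) (E : Fin m → V × V) :
    remove (f v) (Prod.map f f ∘ E) = Prod.map f f ∘ remove v E := by
  funext i
  simp only [remove, removeEdge, Function.comp_apply, Prod.map_fst, Prod.map_snd, hf.eq_iff,
    apply_ite (Prod.map f f), Prod.map_apply]

theorem between_map (hf : f.Injective) (u v : V) (E : Fin m → V × V) :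
    between (f u) (f v) (Prod.map f f ∘ E) = between u v E := by
  ext i
  simp only [mem_between, Function.comp_apply, Prod.ext_iff, Prod.map_fst, Prod.map_snd, hf.eq_iff,
    hf.ne_iff]

theorem otherEnd_map (hf : f.Injective) (v u : V) (e : V × V) :
    otherEnd (f v) (f u) (Prod.map f f e) = f (otherEnd v u e) := by
  simp only [otherEnd, Prod.map_fst, Prod.map_snd, hf.eq_iff, apply_ite f]

theorem neighbour_map (hf : f.Injective) (E : Fin m → V × V) (v : V) :
    neighbour (Prod.map f f ∘ E) (f v) = f (neighbour E v) := by
  rw [neighbour, neighbour, ← List.map_ofFn, List.foldl_map]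
  exact List.foldl_hom f fun u e => otherEnd_map hf v u e

namespace Node

/-- The node with its vertices relabelled by `f`. -/
def map (f : V → W) (N : Node m V) : Node m W := ⟨Prod.map f f ∘ N.edges, f N.vertex⟩

theorem child_map (hf : f.Injective) (N : Node m V) (r : ℕ) :
    (N.map f).child r = (N.child r).map f := by
  have hu : (N.map f).neighbour = f N.neighbour := neighbour_map hf _ _
  match r with
  | 0 => simp only [child, hu]; exact congrArg (Node.mk · _) (cut_map hf ..)
  | 1 => simp only [child, hu]; exact congrArg (Node.mk · _) (merge_map hf ..)
  | _ + 2 => simp only [child, hu]; exact congrArg (Node.mk · _) (remove_map hf ..)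

theorem approxRatio_map (q w : ℂ) (hf : f.Injective) (k : ℕ) (N : Node m V) :
    (N.map f).approxRatio q w k = N.approxRatio q w k := by
  induction k generalizing N with
  | zero => rfl
  | succ k ih =>
    have hweight : (N.map f).weight q w = N.weight q w := by
      simp only [weight, neighbour, map, contractWeight, neighbour_map hf, between_map hf]
    simp only [approxRatio, child_map hf, ih, hweight]

end Node

end EdgeFamily

/-! ### Correctness and running time -/

namespace ComplexRAM

open Program
open EdgeFamily (Node)

variable {S m n : ℕ} {s : State} {q w : ℂ}

theorem approxRatio_rootAt (q w : ℂ) (k : ℕ) (E : Fin m → Fin n × Fin n) (i : Fin n) :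
    (rootAt (Prod.map Fin.val Fin.val ∘ E) i).approxRatio q w k =
      Node.approxRatio q w k ⟨EdgeFamily.dropBelow i E, i⟩ := by
  rw [← Node.approxRatio_map q w Fin.val_injective]
  congr 1
  refine congrArg (Node.mk · _) (funext fun j => ?_)
  simp only [EdgeFamily.dropBelow, Function.comp_apply, Prod.map_fst, Prod.map_snd,
    apply_ite (Prod.map Fin.val Fin.val), Prod.map_apply]

theorem exists_reaches_forLoop_processVertex {E : Fin m → Fin n × Fin n} {k : ℕ}
    (hn : s.nat Mem.n 0 = n) (hnS : n ≤ S) (hm : s.nat Mem.m 0 = m) (hmS : m ≤ S)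
    (hq : s.num Mem.q 0 = q) (hw : s.num Mem.w 0 = w)
    (hsize : s.nat Mem.size 0 = Node.levelStart k) (hkS : Node.levelStart k ≤ S)
    (hout : s.num Mem.out 0 = 1) (hE : s.block m 0 = Prod.map Fin.val Fin.val ∘ E)
    (hdev : ∀ i, s.num Mem.dev i = 0) :
    ∃ s', (forLoop Mem.i Mem.n processVertex).Reaches S s s' ∧
      s'.num Mem.out 0 = EdgeFamily.approxClusterSum q w k E := by
  obtain ⟨s', hs', -, -, hprod⟩ := exists_reaches_forLoop (x := Mem.i) (p := processVertex)
    (I := fun l s' => s'.block m 0 = Prod.map Fin.val Fin.val ∘ E ∧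
      (∀ i ≥ Node.levelStart k, s'.num Mem.dev i = 0) ∧
      s'.num Mem.out 0 = ∏ i ∈ Finset.range l, q *
        (rootAt (Prod.map Fin.val Fin.val ∘ E) i).approxRatio q w k)
    hn hnS ⟨hE, fun i _ => hdev i, by simpa using hout⟩
    fun l _ s' hs' hi ⟨hE', hdev', hout'⟩ => by
      obtain ⟨s'', hs'', hE'', hdev'', hout''⟩ := exists_reaches_processVertex (q := q) (w := w)
        (by rwa [hs'.nat_eq _ (by decide)]) hmS (by rwa [hs'.num_eq _ (by decide)])
        (by rwa [hs'.num_eq _ (by decide)]) (by rwa [hs'.nat_eq _ (by decide)]) hkS hE' hdev'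
      refine ⟨s'', hs'', hE'', hdev'', ?_⟩
      rw [hout'', hout', hi, Node.heapValue_levelStart, Finset.prod_range_succ]
  refine ⟨s', hs', ?_⟩
  rw [hprod, Finset.prod_range]
  simp only [approxRatio_rootAt, EdgeFamily.approxClusterSum]

theorem num_gap_run_initSize {ε : ℝ} (hε : s.num Mem.eps 0 = ε) :
    (initSize.run s).num Mem.gap 0 = (min ε 1 : ℝ) := by
  rcases le_total ε 1 with h | h
  · simp [initSize, assign, run, Test.Holds, NumExp.eval, NatExp.eval, hε, h]
  · obtain rfl | h := h.eq_or_lt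
    · simp [initSize, assign, run, Test.Holds, NumExp.eval, NatExp.eval, hε]
    · simp [initSize, assign, run, Test.Holds, NumExp.eval, NatExp.eval, hε, h.le, h.not_ge]

theorem exists_reaches_chooseSize {c k : ℕ} {ε : ℝ} (hε : s.num Mem.eps 0 = ε) (hkS : k ≤ S)
    (hk : c * (s.nat Mem.n 0 : ℝ) < 2 ^ k * min ε 1)
    (hmin : ∀ j < k, 2 ^ j * min ε 1 ≤ c * (s.nat Mem.n 0 : ℝ)) :
    ∃ s', (chooseSize c).Reaches S s s' ∧ s'.nat Mem.size 0 = Node.levelStart k := by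
  have hinit := reaches_run (p := initSize) S s
  obtain ⟨s', hs', -, -, hsize⟩ := exists_reaches_loop (s := initSize.run s)
    (b := .reLe (.get Mem.gap (.const 0)) (.mul (.ofNat (.const c)) (.ofNat (reg Mem.n))))
    (p := growSize)
    (I := fun j s' => s'.nat Mem.n 0 = s.nat Mem.n 0 ∧
      s'.num Mem.gap 0 = (2 ^ j * min ε 1 : ℝ) ∧ s'.nat Mem.size 0 = Node.levelStart j) hkS
    ⟨by rw [hinit.nat_eq], by rw [num_gap_run_initSize hε, pow_zero, one_mul], rfl⟩
    (fun j hj s' ⟨hn, hgap, hsize⟩ => by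
      have hgrow := reaches_run (p := growSize) S s'
      refine ⟨?_, _, hgrow, by rw [hgrow.nat_eq, hn], ?_, ?_⟩
      · simpa only [Test.Holds, NumExp.eval, NatExp.eval, hn, hgap, ← Complex.ofReal_natCast,
          ← Complex.ofReal_mul, Complex.ofReal_re] using hmin j hj
      · change s'.num Mem.gap 0 + s'.num Mem.gap 0 = _
        rw [hgap]
        push_cast
        ring
      · change s'.nat Mem.size 0 + s'.nat Mem.size 0 + s'.nat Mem.size 0 + 1 = _
        rw [hsize, Node.levelStart]
        ring)
    fun s' ⟨hn, hgap, _⟩ => by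
      simpa only [Test.Holds, NumExp.eval, NatExp.eval, hn, hgap, ← Complex.ofReal_natCast,
        ← Complex.ofReal_mul, Complex.ofReal_re, not_le] using hk
  exact ⟨s', hinit.seq hs', hsize⟩

theorem exists_reaches_approxTutte {α β : Type*} {G : Graph α β} (L : G.EdgeList) {c k : ℕ} {ε : ℝ}
    (q w : ℂ) (hn : L.n ≤ S) (hm : L.m ≤ S) (hkS : Node.levelStart k ≤ S) (hkS' : k ≤ S)
    (hk : c * (L.n : ℝ) < 2 ^ k * min ε 1) (hmin : ∀ j < k, 2 ^ j * min ε 1 ≤ c * (L.n : ℝ)) :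
    ∃ s, (approxTutte c).Reaches S (input L q w ε) s ∧
      s.output = EdgeFamily.approxClusterSum q w k (EdgeFamily.ends L) := by
  obtain ⟨s₁, hs₁, hsize⟩ := exists_reaches_chooseSize (s := input L q w ε) rfl hkS' hk hmin
  have hout := reaches_run (p := .setNum Mem.out (.const 0) (.ofNat (.const 1))) S s₁
  have h₁ := hs₁.seq hout
  have hnat : ∀ x ≠ Mem.size, (run (.setNum Mem.out (.const 0) (.ofNat (.const 1))) s₁).nat x =
      (input L q w ε).nat x := fun x hx => h₁.nat_eq (by
        simpa [chooseSize, initSize, growSize, natTargets, assign] using hx)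
  have hnum : ∀ x ≠ Mem.gap, s₁.num x =
      (input L q w ε).num x := fun x hx => hs₁.num_eq (by
        simpa [chooseSize, initSize, growSize, numTargets, assign] using hx)
  have hblock : (run (.setNum Mem.out (.const 0) (.ofNat (.const 1))) s₁).block L.m 0 =
      Prod.map Fin.val Fin.val ∘ EdgeFamily.ends L := by
    funext j
    simp only [State.block, State.edgeAt, hnat Mem.fst (by decide), hnat Mem.snd (by decide)]
    simp [input, EdgeFamily.ends]
  obtain ⟨s₂, hs₂, hprod⟩ := exists_reaches_forLoop_processVertex (q := q) (w := w) (k := k)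
    (by rw [hnat _ (by decide)]; rfl) hn (by rw [hnat _ (by decide)]; rfl) hm
    (by rw [hout.num_eq, hnum _ (by decide)]; rfl) (by rw [hout.num_eq, hnum _ (by decide)]; rfl)
    (by rw [hout.nat_eq, hsize]) hkS (by simp [run, NumExp.eval, NatExp.eval]) hblock
    (fun i => by rw [hout.num_eq, hnum _ (by decide)]; rfl)
  exact ⟨s₂, hs₁.seq (hout.seq hs₂), hprod⟩

end ComplexRAM

theorem exists_least_lt_two_pow_mul (y : ℝ) {δ : ℝ} (hδ : 0 < δ) :
    ∃ k : ℕ, y < 2 ^ k * δ ∧ (∀ j < k, 2 ^ j * δ ≤ y) ∧ 2 ^ k ≤ max 1 (2 * y / δ) := by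
  classical
  have hex : ∃ k : ℕ, y < 2 ^ k * δ := by
    simpa only [div_lt_iff₀ hδ] using pow_unbounded_of_one_lt (y / δ) one_lt_two
  have hmin (j : ℕ) (hj : j < Nat.find hex) : 2 ^ j * δ ≤ y := not_lt.1 (Nat.find_min hex hj)
  refine ⟨Nat.find hex, Nat.find_spec hex, hmin, ?_⟩
  rcases hk : Nat.find hex with _ | k
  · exact (pow_zero _).trans_le (le_max_left _ _)
  · refine le_max_of_le_right ((le_div_iff₀ hδ).2 ?_)
    rw [pow_succ]
    linarith [hmin k (by omega)]

theorem add_three_pow_le {c Δ n m k : ℕ} {X : ℝ} (hX : 1 ≤ X) (hn : n ≤ X) (hm : m ≤ Δ * n)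
    (hk : (2 : ℝ) ^ k ≤ 2 * (c + 1) * X) :
    ((n + m + 3 ^ k : ℕ) : ℝ) ≤ (1 + Δ + 4 * (c + 1) ^ 2) * X ^ 2 := by
  have hXX : X ≤ X ^ 2 := le_self_pow₀ hX two_ne_zero
  have hm' : (m : ℝ) ≤ Δ * X ^ 2 :=
    calc (m : ℝ) ≤ Δ * n := by exact_mod_cast hm
      _ ≤ Δ * X ^ 2 := by gcongr; exact hn.trans hXX
  have hk' : (3 : ℝ) ^ k ≤ 4 * (c + 1) ^ 2 * X ^ 2 :=
    calc (3 : ℝ) ^ k ≤ (2 ^ 2) ^ k := by gcongr; norm_num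
      _ = (2 ^ k) ^ 2 := by rw [← pow_mul, ← pow_mul, mul_comm]
      _ ≤ (2 * (c + 1) * X) ^ 2 := by gcongr
      _ = 4 * (c + 1) ^ 2 * X ^ 2 := by ring
  push_cast
  linarith

namespace ComplexRAM

open Program

theorem Program.exists_time_le (p : Program) (A : ℕ) :
    ∃ C : ℕ, ∀ (S : ℕ) (X : ℝ), 1 ≤ S → 1 ≤ X → S ≤ A * X ^ 2 → p.time S ≤ C * X ^ C := by
  obtain ⟨P, hP⟩ := p.exists_polynomial_time_eq
  obtain ⟨D, hD⟩ := exists_polynomial_eval_le P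
  refine ⟨D * A ^ D + 2 * D, fun S X hS hX hSX => ?_⟩
  calc (p.time S : ℝ) ≤ D * (S : ℝ) ^ D := by rw [hP]; exact_mod_cast hD S hS
    _ ≤ D * (A * X ^ 2) ^ D := by gcongr
    _ = (D * A ^ D : ℕ) * X ^ (2 * D) := by push_cast; rw [mul_pow, ← pow_mul]; ring
    _ ≤ (D * A ^ D + 2 * D : ℕ) * X ^ (D * A ^ D + 2 * D) := by gcongr <;> omega

theorem exists_exec_approxTutte (c Δ : ℕ) :
    ∃ C : ℕ, ∀ {α β : Type*} {G : Graph α β} (L : G.EdgeList), L.m ≤ Δ * L.n →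
      ∀ (q w : ℂ) {ε : ℝ}, 0 < ε → ∃ s t k, Exec (approxTutte c) (input L q w ε) s t ∧
        s.output = EdgeFamily.approxClusterSum q w k (EdgeFamily.ends L) ∧
        c * L.n ≤ 2 ^ k * min ε 1 ∧ (t : ℝ) ≤ C * (max (L.n : ℝ) 1 / min ε 1) ^ C := by
  obtain ⟨C, hC⟩ := (approxTutte c).exists_time_le (1 + Δ + 4 * (c + 1) ^ 2)
  refine ⟨C, fun {α β G} L hm q w ε hε => ?_⟩
  have hδ : 0 < min ε 1 := lt_min hε one_pos
  set X := max (L.n : ℝ) 1 / min ε 1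
  have hX : max (L.n : ℝ) 1 ≤ X := le_div_self (by positivity) hδ (min_le_right _ _)
  have hX1 : 1 ≤ X := (le_max_right _ _).trans hX
  obtain ⟨k, hk, hmin, hle⟩ := exists_least_lt_two_pow_mul (c * L.n : ℝ) hδ
  have hkX : (2 : ℝ) ^ k ≤ 2 * (c + 1) * X := by
    refine hle.trans (max_le (by nlinarith) ?_)
    calc 2 * (c * L.n : ℝ) / min ε 1 = 2 * c * (L.n / min ε 1) := by ring
      _ ≤ 2 * (c + 1) * X := by
        gcongr
        · exact le_add_of_nonneg_right zero_le_one
        · exact div_le_div_of_nonneg_right (le_max_left _ _) hδ.le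
  have hlevel := EdgeFamily.Node.levelStart_lt_three_pow k
  have hk3 : k < 3 ^ k := k.lt_pow_self (by norm_num)
  obtain ⟨s, ⟨t, ht, hexec⟩, hs⟩ := exists_reaches_approxTutte (S := L.n + L.m + 3 ^ k) L q w
    (by omega) (by omega) (by omega) (by omega) hk hmin
  have hS := add_three_pow_le hX1 ((le_max_left _ _).trans hX) hm hkX
  exact ⟨s, t, k, hexec, hs, hk.le, (Nat.cast_le.2 ht).trans
    (hC _ X (by omega) hX1 (by exact_mod_cast hS))⟩

end ComplexRAM

theorem theorem1p4 (Δ : ℕ) (w : ℂ) :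
    ∃ K : ℝ, ∀ q : ℂ, K < ‖q‖ →
      ∃ (P : ComplexRAM.Program) (C : ℕ),
        ∀ (α β : Type) (G : Graph α β), G.Loopless → (∀ v ∈ V(G), G.degree v ≤ Δ) →
          ∀ (L : G.EdgeList) (ε : ℝ), 0 < ε →
            ∃ (s : ComplexRAM.State) (t : ℕ),
              ComplexRAM.Exec P (ComplexRAM.input L q w ε) s t ∧
              IsMultApprox ε (G.tutte q w) s.output ∧
              (t : ℝ) ≤ C * (max (V(G).ncard : ℝ) 1 / min ε 1) ^ C := by
  refine ⟨((1 + ‖w‖) ^ Δ + 1) * (32 * 16 ^ Δ), fun q hq => ?_⟩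
  obtain ⟨C, hC⟩ := ComplexRAM.exists_exec_approxTutte (16 * 4 ^ Δ) Δ
  refine ⟨ComplexRAM.approxTutte (16 * 4 ^ Δ), C, fun α β G hG hΔ L ε hε => ?_⟩
  have hdeg (v : Fin L.n) : EdgeFamily.liveDegree (EdgeFamily.ends L) v ≤ Δ :=
    (EdgeFamily.liveDegree_ends_le L v).trans (hΔ _ (L.vert v).2)
  have hm : L.m ≤ Δ * L.n := by
    simpa [EdgeFamily.live_ends L hG] using EdgeFamily.card_live_le hdeg
  obtain ⟨s, t, k, hexec, hs, hk, ht⟩ := hC L hm q w hε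
  refine ⟨s, t, hexec, ?_, by rwa [EdgeFamily.ncard_vertexSet L]⟩
  rw [hs, EdgeFamily.tutte_eq_clusterSum L hG]
  exact EdgeFamily.isMultApprox_approxClusterSum (EdgeFamily.isContracting_of_lt hq) hdeg
    (by exact_mod_cast hk)
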